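/- Let $d\in\mathbb N$ and write $\hat u(\xi)=\int_{\mathbb R^d} e^{i\langle\xi,x\rangle}u(x)\,dx$ for the Fourier transform, extended to tempered distributions by $\langle\hat u,\varphi\rangle=\langle u,\hat\varphi\rangle$. For $s\in\mathbb R$ let $H^s(\mathbb R^d)$ be the space of all (complex-valued) tempered distributions $u$ whose Fourier transform is a locally integrable function with $$\|u\|_s^2=\int_{\mathbb R^d}|\hat u(\xi)|^2(1+|\xi|)^{2s}\,d\xi<\infty .$$ Let $A:\mathbb R^d\to\mathbb C$ be a Borel measurable function that has Sobolev index $\alpha\in(0,2]$, i.e. there are constants $C_1,C_3\ge 0$, $C_2>0$ and $0\le\beta<\alpha$ such that for all $\xi\in\mathbb R^d$ $$|A(\xi)|\le C_1(1+|\xi|^2)^{\alpha/2}\qquad\text{and}\qquad \operatorname{Re}A(\xi)\ge C_2|\xi|^\alpha-C_3(1+|\xi|^2)^{\beta/2}.$$ Let $\mathcal A$ be the pseudo-differential operator with symbol $A$, that is, $\mathcal A u(x)=(2\pi)^{-d}\int A(\xi)\hat u(\xi)e^{-i\langle x,\xi\rangle}\,d\xi$ for Schwartz functions $u$, extended to the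 continuous linear operator $\mathcal A:H^{\alpha/2}(\mathbb R^d)\to H^{-\alpha/2}(\mathbb R^d)$ with $\widehat{\mathcal A u}=A\hat u$. Let $0<T<\infty$. Let $W^1(0,T;H^{\alpha/2}(\mathbb R^d),L^2(\mathbb R^d))$ be the space of all $u\in L^2(0,T;H^{\alpha/2}(\mathbb R^d))$ whose distributional time derivative $\partial_t u$ belongs to $L^2(0,T;H^{-\alpha/2}(\mathbb R^d))$, where $H^{-\alpha/2}(\mathbb R^d)$ is identified with the dual of $H^{\alpha/2}(\mathbb R^d)$ through the pivot space $L^2(\mathbb R^d)$. Then for every $f\in L^2(0,T;H^{-\alpha/2}(\mathbb R^d))$ and every $g\in L^2(\mathbb R^d)$ the parabolic equation $$\partial_t u+\mathcal A u=f,\qquad u(0)=g,$$ has a unique weak solution $u\in W^1(0,T;H^{\alpha/2}(\mathbb R^d),L^2(\mathbb R^d))$. Here $u$ is a weak solution if the equation holds in $H^{-\alpha/2}(\mathbb R^d)$ for almost every $t\in(0,T)$, and $u$ has a representative that is continuous from $[0,T]$ to $L^2(\mathbb R^d)$ and takes the value $g$ at $t=0$. -/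

import Mathlib

open MeasureTheory SchwartzMap

open scoped FourierTransform ENNReal ContDiff

noncomputable section

namespace SobolevIndex

/-- The Euclidean space `ℝᵈ`. -/
abbrev Rd (d : ℕ) : Type := EuclideanSpace ℝ (Fin d)

/-! ### The Fourier transform `û(ξ) = ∫ e^{i⟨ξ,x⟩} u(x) dx` -/

/-- The scaling `x ↦ (2π)⁻¹ x` of `ℝᵈ`. -/
def scaling (d : ℕ) : Rd d ≃L[ℝ] Rd d :=
  ContinuousLinearEquiv.smulLeft (Units.mk0 ((2 * Real.pi)⁻¹ : ℝ) (by positivity))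

theorem scaling_apply (d : ℕ) (x : Rd d) : scaling d x = (2 * Real.pi)⁻¹ • x := rfl

/-- Composition of Schwartz functions with the scaling `x ↦ (2π)⁻¹ x`. -/
def dilation (d : ℕ) : 𝓢(Rd d, ℂ) ≃L[ℂ] 𝓢(Rd d, ℂ) :=
  ContinuousLinearEquiv.equivOfInverse
    (compCLMOfContinuousLinearEquiv ℂ (scaling d))
    (compCLMOfContinuousLinearEquiv ℂ (scaling d).symm)
    (fun φ ↦ by ext x; simp) (fun φ ↦ by ext x; simp)

/-- The Fourier transform `φ̂(ξ) = ∫ e^{i⟨ξ,x⟩} φ(x) dx` on Schwartz functions; the formula is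
`fourierS_apply`. -/
def fourierS (d : ℕ) : 𝓢(Rd d, ℂ) ≃L[ℂ] 𝓢(Rd d, ℂ) :=
  (FourierTransform.fourierCLE ℂ 𝓢(Rd d, ℂ)).symm.trans (dilation d)

theorem fourierS_eq {d : ℕ} (φ : 𝓢(Rd d, ℂ)) (ξ : Rd d) :
    fourierS d φ ξ = 𝓕⁻ (φ : Rd d → ℂ) ((2 * Real.pi)⁻¹ • ξ) := by
  rw [← fourierInv_coe]
  rfl

theorem fourierS_apply {d : ℕ} (φ : 𝓢(Rd d, ℂ)) (ξ : Rd d) :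
    fourierS d φ ξ = ∫ x, Complex.exp (Complex.I * (inner ℝ ξ x : ℝ)) * φ x := by
  rw [fourierS_eq, Real.fourierInv_eq']
  refine integral_congr_ae (.of_forall fun x ↦ ?_)
  simp only [smul_eq_mul]
  congr 2
  rw [inner_smul_right, real_inner_comm, mul_comm]
  congr 2
  field_simp

/-- Fourier inversion: `φ(x) = (2π)⁻ᵈ ∫ e^{-i⟨x,ξ⟩} φ̂(ξ) dξ`. -/
theorem fourierS_inversion {d : ℕ} (φ : 𝓢(Rd d, ℂ)) (x : Rd d) :
    φ x = ((2 * Real.pi) ^ d)⁻¹ *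
      ∫ ξ, Complex.exp (-Complex.I * (inner ℝ x ξ : ℝ)) * fourierS d φ ξ := by
  have h1 : φ x = 𝓕 (𝓕⁻ φ : 𝓢(Rd d, ℂ)) x := by simp
  rw [h1, fourier_coe, Real.fourier_eq']
  have h2 := Measure.integral_comp_inv_smul (volume : Measure (Rd d))
    (fun v ↦ Complex.exp (↑(-2 * Real.pi * inner ℝ v x) * Complex.I) • (𝓕⁻ φ : 𝓢(Rd d, ℂ)) v)
    (2 * Real.pi)
  have h3 : (∫ ξ, Complex.exp (-Complex.I * (inner ℝ x ξ : ℝ)) * fourierS d φ ξ) =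
      ∫ v : Rd d, Complex.exp (↑(-2 * Real.pi * inner ℝ ((2 * Real.pi)⁻¹ • v) x) * Complex.I) •
        (𝓕⁻ φ : 𝓢(Rd d, ℂ)) ((2 * Real.pi)⁻¹ • v) := by
    refine integral_congr_ae (.of_forall fun v ↦ ?_)
    simp only [smul_eq_mul]
    rw [fourierS_eq, fourierInv_coe, inner_smul_left, real_inner_comm]
    congr 2
    rw [mul_comm]
    push_cast
    simp
    field_simp
  rw [h3, h2, abs_of_pos (by positivity), finrank_euclideanSpace, Fintype.card_fin,
    Complex.real_smul]
  push_cast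
  rw [inv_mul_cancel_left₀]
  exact pow_ne_zero _ (mul_ne_zero two_ne_zero (by exact_mod_cast Real.pi_ne_zero))

/-- Fubini for the kernel `e^{i c ⟨x,ξ⟩}`. -/
theorem integral_kernel_flip {d : ℕ} (c : ℝ) {f g : Rd d → ℂ} (hf : Integrable f)
    (hg : Integrable g) :
    ∫ ξ, (∫ x, Complex.exp (Complex.I * (c * inner ℝ ξ x : ℝ)) * f x) * g ξ =
      ∫ x, f x * ∫ ξ, Complex.exp (Complex.I * (c * inner ℝ x ξ : ℝ)) * g ξ := by
  have key := VectorFourier.integral_fourierIntegral_smul_eq_flip (e := Real.fourierChar)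
    (L := (-(c / (2 * Real.pi))) • innerₗ (Rd d)) (μ := volume) (ν := volume)
    Real.continuous_fourierChar (by simp only [LinearMap.smul_apply]; simp; fun_prop) hf hg
  have e1 : ∀ (h : Rd d → ℂ) (ξ : Rd d),
      VectorFourier.fourierIntegral Real.fourierChar volume
        ((-(c / (2 * Real.pi))) • innerₗ (Rd d)) h ξ =
      ∫ x, Complex.exp (Complex.I * (c * inner ℝ ξ x : ℝ)) * h x := by
    intro h ξ
    refine integral_congr_ae (.of_forall fun x ↦ ?_)
    simp only [LinearMap.smul_apply, innerₗ_apply_apply, Circle.smul_def, smul_eq_mul,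
      Real.fourierChar_apply]
    congr 2
    rw [real_inner_comm x ξ, mul_comm]
    congr 2
    field_simp
  have e2 : ((-(c / (2 * Real.pi))) • innerₗ (Rd d)).flip =
      (-(c / (2 * Real.pi))) • innerₗ (Rd d) := by
    ext x y
    simp [real_inner_comm]
  rw [e2] at key
  simpa only [e1, smul_eq_mul] using key

/-- The Fourier transform `û` of a tempered distribution `u`, given by `⟨û, φ⟩ = ⟨u, φ̂⟩`, is
represented by the locally integrable function `h`. -/
def HasFourierTransform {d : ℕ} (u : 𝓢'(Rd d, ℂ)) (h : Rd d → ℂ) : Prop :=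
  LocallyIntegrable h ∧
    ∀ φ : 𝓢(Rd d, ℂ), Integrable (fun ξ ↦ φ ξ * h ξ) ∧ u (fourierS d φ) = ∫ ξ, φ ξ * h ξ

theorem HasFourierTransform.unique {d : ℕ} {u : 𝓢'(Rd d, ℂ)} {h₁ h₂ : Rd d → ℂ}
    (H₁ : HasFourierTransform u h₁) (H₂ : HasFourierTransform u h₂) : h₁ =ᵐ[volume] h₂ := by
  refine ae_eq_of_integral_contDiff_smul_eq H₁.1 H₂.1 fun g g_smooth g_cpt ↦ ?_
  have hg₁ : HasCompactSupport (Complex.ofRealCLM ∘ g) := g_cpt.comp_left rfl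
  have hg₂ : ContDiff ℝ ∞ (Complex.ofRealCLM ∘ g) := by fun_prop
  have := (H₁.2 (hg₁.toSchwartzMap hg₂)).2.symm.trans (H₂.2 (hg₁.toSchwartzMap hg₂)).2
  simpa using this

theorem HasFourierTransform.congr {d : ℕ} {u : 𝓢'(Rd d, ℂ)} {h₁ h₂ : Rd d → ℂ}
    (H₁ : HasFourierTransform u h₁) (h : h₁ =ᵐ[volume] h₂) : HasFourierTransform u h₂ := by
  refine ⟨H₁.1.congr h, fun φ ↦ ?_⟩
  have e : (fun ξ ↦ φ ξ * h₁ ξ) =ᵐ[volume] fun ξ ↦ φ ξ * h₂ ξ := by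
    filter_upwards [h] with ξ hξ
    rw [hξ]
  exact ⟨(H₁.2 φ).1.congr e, (H₁.2 φ).2.trans (integral_congr_ae e)⟩

theorem HasFourierTransform.add {d : ℕ} {u₁ u₂ : 𝓢'(Rd d, ℂ)} {h₁ h₂ : Rd d → ℂ}
    (H₁ : HasFourierTransform u₁ h₁) (H₂ : HasFourierTransform u₂ h₂) :
    HasFourierTransform (u₁ + u₂) (h₁ + h₂) := by
  refine ⟨H₁.1.add H₂.1, fun φ ↦ ?_⟩
  simp only [Pi.add_apply, mul_add]
  refine ⟨(H₁.2 φ).1.add (H₂.2 φ).1, ?_⟩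
  rw [integral_add (H₁.2 φ).1 (H₂.2 φ).1, ← (H₁.2 φ).2, ← (H₂.2 φ).2]
  rfl

theorem HasFourierTransform.smul {d : ℕ} {u : 𝓢'(Rd d, ℂ)} {h : Rd d → ℂ} (c : ℂ)
    (H : HasFourierTransform u h) : HasFourierTransform (c • u) (c • h) := by
  refine ⟨H.1.smul c, fun φ ↦ ?_⟩
  simp only [Pi.smul_apply, smul_eq_mul, mul_left_comm _ c]
  refine ⟨(H.2 φ).1.const_mul c, ?_⟩
  rw [integral_const_mul, ← (H.2 φ).2]
  rfl

/-- A Schwartz function, viewed as a distribution, has its classical Fourier transform. -/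
theorem hasFourierTransform_schwartz {d : ℕ} (φ : 𝓢(Rd d, ℂ)) :
    HasFourierTransform (φ : 𝓢'(Rd d, ℂ)) (fourierS d φ) := by
  refine ⟨(fourierS d φ).integrable.locallyIntegrable, fun ψ ↦ ⟨?_, ?_⟩⟩
  · have h : MemLp (fourierS d φ) ∞ volume := (fourierS d φ).memLp ∞ volume
    exact ψ.integrable.mul_of_top_left h
  · rw [SchwartzMap.coe_apply]
    have := integral_kernel_flip 1 (ψ.integrable (μ := volume)) (φ.integrable (μ := volume))
    simpa only [one_mul, ← fourierS_apply, smul_eq_mul] using this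

/-! ### Sobolev–Slobodeckii spaces -/

/-- The weight `(1 + |ξ|)ˢ`. -/
def weight {d : ℕ} (s : ℝ) (ξ : Rd d) : ℝ := (1 + ‖ξ‖) ^ s

theorem weight_pos {d : ℕ} (s : ℝ) (ξ : Rd d) : 0 < weight s ξ := by
  unfold weight; positivity

theorem continuous_weight {d : ℕ} (s : ℝ) : Continuous (weight (d := d) s) := by
  unfold weight
  exact Continuous.rpow_const (by fun_prop) fun ξ ↦ Or.inl (by positivity)

theorem weight_mul {d : ℕ} (s r : ℝ) (ξ : Rd d) :
    weight s ξ * weight r ξ = weight (s + r) ξ := by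
  unfold weight; rw [Real.rpow_add (by positivity)]

theorem weight_neg_mul {d : ℕ} (s : ℝ) (ξ : Rd d) : weight (-s) ξ * weight s ξ = 1 := by
  rw [weight_mul]; simp [weight]

theorem weight_mul_neg {d : ℕ} (s : ℝ) (ξ : Rd d) : weight s ξ * weight (-s) ξ = 1 := by
  rw [weight_mul]; simp [weight]

/-- The weights `(1 + |ξ|)ˢ` and `(1 + |ξ|²)^(s/2)` are comparable. -/
theorem weight_le {d : ℕ} (s : ℝ) (ξ : Rd d) :
    weight s ξ * (1 + ‖ξ‖ ^ 2) ^ (-s / 2) ≤ 2 ^ (|s| / 2) := by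
  set k : ℝ := (1 + ‖ξ‖) ^ 2 / (1 + ‖ξ‖ ^ 2) with hk
  have hpos : (0 : ℝ) < 1 + ‖ξ‖ ^ 2 := by positivity
  have hn := norm_nonneg ξ
  have hk1 : 1 ≤ k := by rw [hk, one_le_div hpos]; nlinarith
  have hk2 : k ≤ 2 := by rw [hk, div_le_iff₀ hpos]; nlinarith [sq_nonneg (1 - ‖ξ‖)]
  have e : weight s ξ * (1 + ‖ξ‖ ^ 2) ^ (-s / 2) = k ^ (s / 2) := by
    have e1 : ((1 + ‖ξ‖) ^ 2) ^ (s / 2) = (1 + ‖ξ‖) ^ s := by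
      rw [← Real.rpow_natCast_mul (by positivity)]
      congr 1
      push_cast
      ring
    rw [hk, Real.div_rpow (by positivity) hpos.le, e1, neg_div, Real.rpow_neg hpos.le, weight]
    exact (div_eq_mul_inv _ _).symm
  rw [e]
  calc k ^ (s / 2) ≤ k ^ (|s| / 2) :=
        Real.rpow_le_rpow_of_exponent_le hk1 (by linarith [le_abs_self s])
    _ ≤ 2 ^ (|s| / 2) := Real.rpow_le_rpow (by linarith) hk2 (by positivity)

/-- Bounded measurable functions are multipliers of square integrable functions. -/
theorem memLp_bdd_mul {d : ℕ} {a g : Rd d → ℂ} (ha : AEStronglyMeasurable a volume) (C : ℝ)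
    (hC : ∀ ξ, ‖a ξ‖ ≤ C) (hg : MemLp g 2 volume) : MemLp (fun ξ ↦ a ξ * g ξ) 2 volume :=
  hg.mul (memLp_top_of_bound ha C (.of_forall hC))

theorem memLp_weight_schwartz {d : ℕ} (s : ℝ) (φ : 𝓢(Rd d, ℂ)) :
    MemLp (fun ξ ↦ (weight s ξ : ℂ) * φ ξ) 2 volume := by
  have hG := Function.hasTemperateGrowth_one_add_norm_sq_rpow (Rd d) (s / 2)
  have h1 : MemLp (smulLeftCLM ℂ (fun ξ : Rd d ↦ (1 + ‖ξ‖ ^ 2) ^ (s / 2)) φ) 2 volume :=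
    SchwartzMap.memLp _ _ _
  have h2 := memLp_bdd_mul
    (a := fun ξ : Rd d ↦ ((weight s ξ * (1 + ‖ξ‖ ^ 2) ^ (-s / 2) : ℝ) : ℂ))
    (by
      refine (Complex.continuous_ofReal.comp ((continuous_weight s).mul ?_)).aestronglyMeasurable
      exact Continuous.rpow_const (by fun_prop) fun ξ ↦ Or.inl (by positivity))
    (2 ^ (|s| / 2))
    (fun ξ ↦ by
      rw [Complex.norm_real, Real.norm_of_nonneg]
      · exact weight_le s ξ
      · have := weight_pos s ξ
        positivity) h1
  refine h2.congr_norm ?_ (.of_forall fun ξ ↦ ?_)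
  · exact ((Complex.continuous_ofReal.comp (continuous_weight s)).mul
      φ.continuous).aestronglyMeasurable
  · have e : (1 + ‖ξ‖ ^ 2) ^ (-s / 2) * (1 + ‖ξ‖ ^ 2) ^ (s / 2) = 1 := by
      rw [← Real.rpow_add (by positivity)]
      simp [neg_div]
    rw [smulLeftCLM_apply_apply hG, Complex.real_smul, ← mul_assoc, ← Complex.ofReal_mul,
      mul_assoc, e, mul_one]

/-- The tempered distributions `u` such that `û` is a locally integrable function with
`∫ |û(ξ)|² (1 + |ξ|)²ˢ dξ < ∞`. -/
def sobolevSubmodule (d : ℕ) (s : ℝ) : Submodule ℂ 𝓢'(Rd d, ℂ) where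
  carrier := {u | ∃ h : Rd d → ℂ, HasFourierTransform u h ∧
    MemLp (fun ξ ↦ (weight s ξ : ℂ) * h ξ) 2 volume}
  add_mem' := by
    rintro u₁ u₂ ⟨h₁, H₁, M₁⟩ ⟨h₂, H₂, M₂⟩
    refine ⟨h₁ + h₂, H₁.add H₂, ?_⟩
    exact (M₁.add M₂).ae_eq (.of_forall fun ξ ↦ by simp only [Pi.add_apply, mul_add])
  zero_mem' := by
    refine ⟨0, ⟨locallyIntegrable_zero, fun φ ↦ ?_⟩, by simp⟩
    simp
  smul_mem' := by
    rintro c u ⟨h, H, M⟩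
    refine ⟨c • h, H.smul c, ?_⟩
    have := M.const_mul c
    simpa only [Pi.smul_apply, smul_eq_mul, mul_left_comm _ c] using this

/-- The Sobolev–Slobodeckii space `Hˢ(ℝᵈ)`; it carries the norm
`‖u‖ₛ = (∫ |û(ξ)|² (1 + |ξ|)²ˢ dξ)^(1/2)`, see `Hs.norm_sq`. (It is a type of its own since
the subspace topology of the tempered distributions is not the topology of `Hˢ`.) -/
def Hs (d : ℕ) (s : ℝ) : Type := ↥(sobolevSubmodule d s)

namespace Hs

variable {d : ℕ} {s : ℝ}

instance : AddCommGroup (Hs d s) := inferInstanceAs (AddCommGroup ↥(sobolevSubmodule d s))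

instance : Module ℂ (Hs d s) := inferInstanceAs (Module ℂ ↥(sobolevSubmodule d s))

/-- The inclusion of `Hˢ(ℝᵈ)` into the tempered distributions. -/
def toDist : Hs d s →ₗ[ℂ] 𝓢'(Rd d, ℂ) := (sobolevSubmodule d s).subtype

theorem toDist_injective : Function.Injective (toDist : Hs d s → 𝓢'(Rd d, ℂ)) :=
  Subtype.val_injective

/-- The function representing `û`. -/
def hat (u : Hs d s) : Rd d → ℂ := u.2.choose

theorem hasFourierTransform_hat (u : Hs d s) : HasFourierTransform (toDist u) (hat u) :=
  u.2.choose_spec.1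

theorem memLp_hat (u : Hs d s) : MemLp (fun ξ ↦ (weight s ξ : ℂ) * hat u ξ) 2 volume :=
  u.2.choose_spec.2

theorem hat_add (u v : Hs d s) : hat (u + v) =ᵐ[volume] hat u + hat v :=
  (hasFourierTransform_hat (u + v)).unique
    (by rw [map_add]; exact (hasFourierTransform_hat u).add (hasFourierTransform_hat v))

theorem hat_smul (c : ℂ) (u : Hs d s) : hat (c • u) =ᵐ[volume] c • hat u :=
  (hasFourierTransform_hat (c • u)).unique
    (by rw [map_smul]; exact (hasFourierTransform_hat u).smul c)

/-- The map `u ↦ (1 + |ξ|)ˢ û(ξ)` into `L²`. -/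
def toL2 : Hs d s →ₗ[ℂ] Lp ℂ 2 (volume : Measure (Rd d)) where
  toFun u := (memLp_hat u).toLp
  map_add' u v := by
    rw [← MemLp.toLp_add]
    refine MemLp.toLp_congr _ _ ?_
    filter_upwards [hat_add u v] with ξ hξ
    simp only [hξ, Pi.add_apply, mul_add]
  map_smul' c u := by
    rw [RingHom.id_apply, ← MemLp.toLp_const_smul]
    refine MemLp.toLp_congr _ _ ?_
    filter_upwards [hat_smul c u] with ξ hξ
    simp only [hξ, Pi.smul_apply, smul_eq_mul, mul_left_comm]

theorem coeFn_toL2 (u : Hs d s) : toL2 u =ᵐ[volume] fun ξ ↦ (weight s ξ : ℂ) * hat u ξ :=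
  (memLp_hat u).coeFn_toLp

theorem toL2_injective : Function.Injective (toL2 : Hs d s → Lp ℂ 2 (volume : Measure (Rd d))) := by
  rw [← LinearMap.ker_eq_bot, LinearMap.ker_eq_bot']
  intro u hu
  apply toDist_injective
  rw [map_zero]
  have h0 : hat u =ᵐ[volume] 0 := by
    filter_upwards [coeFn_toL2 u, Lp.coeFn_zero ℂ 2 (volume : Measure (Rd d))] with ξ h1 h2
    rw [hu, h2] at h1
    simpa [(weight_pos s ξ).ne'] using h1.symm
  ext ψ
  obtain ⟨φ, rfl⟩ := (fourierS d).surjective ψ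
  rw [((hasFourierTransform_hat u).2 φ).2]
  have : (fun ξ ↦ φ ξ * hat u ξ) =ᵐ[volume] fun _ ↦ 0 := by
    filter_upwards [h0] with ξ hξ
    simp [hξ]
  rw [integral_congr_ae this]
  simp

instance : NormedAddCommGroup (Hs d s) := NormedAddCommGroup.induced _ _ toL2 toL2_injective

instance : NormedSpace ℂ (Hs d s) := NormedSpace.induced ℂ _ _ toL2

theorem norm_sq (u : Hs d s) : ‖u‖ ^ 2 = ∫ ξ, ‖hat u ξ‖ ^ 2 * (1 + ‖ξ‖) ^ (2 * s) := by
  have h1 : ‖u‖ ^ 2 = ‖toL2 u‖ ^ 2 := rfl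
  have h2 := L2.integral_inner_eq_sq_eLpNorm (𝕜 := ℂ) (toL2 u)
  have h3 := L2.inner_def (𝕜 := ℂ) (toL2 u) (toL2 u)
  rw [inner_self_eq_norm_sq_to_K] at h3
  have h4 : ((‖u‖ ^ 2 : ℝ) : ℂ) = ((∫ ξ, ‖hat u ξ‖ ^ 2 * (1 + ‖ξ‖) ^ (2 * s) : ℝ) : ℂ) := by
    rw [h1]
    push_cast
    refine h3.trans ?_
    rw [← integral_complex_ofReal]
    refine integral_congr_ae ?_
    filter_upwards [coeFn_toL2 u] with ξ hξ
    rw [hξ, inner_self_eq_norm_sq_to_K, norm_mul, Complex.norm_real,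
      Real.norm_of_nonneg (weight_pos s ξ).le, weight, mul_comm 2 s, Real.rpow_mul (by positivity)]
    push_cast
    norm_num
    ring
  exact_mod_cast h4

/-- The inverse Fourier transform of a square integrable function divided by a weight. -/
theorem exists_hasFourierTransform (s : ℝ) (g : Lp ℂ 2 (volume : Measure (Rd d))) :
    ∃ D : 𝓢'(Rd d, ℂ), HasFourierTransform D (fun ξ ↦ (weight (-s) ξ : ℂ) * g ξ) := by
  have hg := Lp.memLp g
  have hG : Function.HasTemperateGrowth
      fun ξ : Rd d ↦ (((1 + ‖ξ‖ ^ 2) ^ (-s / 2) : ℝ) : ℂ) := by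
    fun_prop
  have hM := memLp_bdd_mul
    (a := fun ξ : Rd d ↦ ((weight (-s) ξ * (1 + ‖ξ‖ ^ 2) ^ (-(-s) / 2) : ℝ) : ℂ))
    (by
      refine (Complex.continuous_ofReal.comp ((continuous_weight _).mul ?_)).aestronglyMeasurable
      exact Continuous.rpow_const (by fun_prop) fun ξ ↦ Or.inl (by positivity))
    (2 ^ (|-s| / 2))
    (fun ξ ↦ by
      rw [Complex.norm_real, Real.norm_of_nonneg]
      · exact weight_le (-s) ξ
      · have := weight_pos (-s) ξ
        positivity) hg
  obtain ⟨f, hf⟩ : ∃ f : Lp ℂ 2 (volume : Measure (Rd d)), f =ᵐ[volume] fun ξ ↦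
      ((weight (-s) ξ * (1 + ‖ξ‖ ^ 2) ^ (-(-s) / 2) : ℝ) : ℂ) * g ξ :=
    ⟨hM.toLp, hM.coeFn_toLp⟩
  refine ⟨PointwiseConvergenceCLM.precomp ℂ
    ((fourierS d).symm : 𝓢(Rd d, ℂ) →L[ℂ] 𝓢(Rd d, ℂ))
    (TemperedDistribution.smulLeftCLM ℂ
      (fun ξ : Rd d ↦ (((1 + ‖ξ‖ ^ 2) ^ (-s / 2) : ℝ) : ℂ)) (f : 𝓢'(Rd d, ℂ))),
    ?_, fun φ ↦ ⟨?_, ?_⟩⟩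
  · exact (hg.locallyIntegrable one_le_two).continuous_smul
      (Complex.continuous_ofReal.comp (continuous_weight (-s)))
  · have := (memLp_weight_schwartz (-s) φ).integrable_mul hg
    refine this.congr (.of_forall fun ξ ↦ ?_)
    simp only [Pi.mul_apply]
    ring
  · change (f : 𝓢'(Rd d, ℂ)) (smulLeftCLM ℂ _ ((fourierS d).symm (fourierS d φ))) = _
    rw [ContinuousLinearEquiv.symm_apply_apply, Lp.toTemperedDistribution_apply]
    refine integral_congr_ae ?_
    filter_upwards [hf] with ξ hξ
    have e2 : (1 + ‖ξ‖ ^ 2) ^ (-s / 2) * (1 + ‖ξ‖ ^ 2) ^ (-(-s) / 2) = 1 := by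
      rw [← Real.rpow_add (by positivity)]
      simp [neg_div]
    rw [hξ, smulLeftCLM_apply_apply hG, smul_eq_mul, smul_eq_mul]
    have e3 := congrArg (fun x : ℝ ↦ (x : ℂ)) e2
    simp only [Complex.ofReal_mul, Complex.ofReal_one] at e3 ⊢
    linear_combination (weight (-s) ξ : ℂ) * φ ξ * g ξ * e3

/-- A distribution whose Fourier transform is `h`, with `(1 + |ξ|)ˢ h(ξ)` square integrable, is an
element of `Hˢ(ℝᵈ)`. -/
theorem exists_toDist_eq {D : 𝓢'(Rd d, ℂ)} {h : Rd d → ℂ} (hD : HasFourierTransform D h)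
    (hM : MemLp (fun ξ ↦ (weight s ξ : ℂ) * h ξ) 2 volume) :
    ∃ u : Hs d s, toDist u = D ∧ hat u =ᵐ[volume] h := by
  have hmem : D ∈ sobolevSubmodule d s := ⟨h, hD, hM⟩
  let u : Hs d s := (⟨D, hmem⟩ : ↥(sobolevSubmodule d s))
  have hu : toDist u = D := rfl
  exact ⟨u, hu, (hasFourierTransform_hat u).unique (hu ▸ hD)⟩

/-- Every square integrable function is `(1 + |ξ|)ˢ û(ξ)` for some `u ∈ Hˢ(ℝᵈ)`. -/
theorem toL2_surjective :
    Function.Surjective (toL2 : Hs d s → Lp ℂ 2 (volume : Measure (Rd d))) := by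
  intro g
  obtain ⟨D, hD⟩ := exists_hasFourierTransform s g
  have e : ∀ ξ, (weight s ξ : ℂ) * ((weight (-s) ξ : ℂ) * g ξ) = g ξ := fun ξ ↦ by
    rw [← mul_assoc, ← Complex.ofReal_mul, weight_mul_neg, Complex.ofReal_one, one_mul]
  obtain ⟨u, -, hu⟩ := exists_toDist_eq (s := s) hD (by simpa only [e] using Lp.memLp g)
  refine ⟨u, Lp.ext ((coeFn_toL2 u).trans ?_)⟩
  filter_upwards [hu] with ξ hξ
  rw [hξ, e]

/-- The isometric isomorphism `u ↦ (1 + |ξ|)ˢ û(ξ)` of `Hˢ(ℝᵈ)` onto `L²(ℝᵈ)`. -/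
def equivL2 (d : ℕ) (s : ℝ) : Hs d s ≃ₗᵢ[ℂ] Lp ℂ 2 (volume : Measure (Rd d)) :=
  LinearIsometryEquiv.ofSurjective ⟨toL2, fun _ ↦ rfl⟩ toL2_surjective

theorem coeFn_equivL2 (u : Hs d s) :
    equivL2 d s u =ᵐ[volume] fun ξ ↦ (weight s ξ : ℂ) * hat u ξ :=
  coeFn_toL2 u

instance : CompleteSpace (Hs d s) :=
  (equivL2 d s).toIsometryEquiv.completeSpace

end Hs

/-- Schwartz functions belong to every `Hˢ(ℝᵈ)`. -/
theorem schwartz_mem_sobolev {d : ℕ} (s : ℝ) (φ : 𝓢(Rd d, ℂ)) :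
    (φ : 𝓢'(Rd d, ℂ)) ∈ sobolevSubmodule d s :=
  ⟨fourierS d φ, hasFourierTransform_schwartz φ, memLp_weight_schwartz s _⟩

/-! ### Pseudo-differential operators and the Sobolev index -/

/-- The symbol class `S⁰ₘ`: measurable `A` with `|A(ξ)| ≤ C (1 + |ξ|)ᵐ`. -/
def IsSymbol {d : ℕ} (m : ℝ) (A : Rd d → ℂ) : Prop :=
  Measurable A ∧ ∃ C : ℝ, 0 ≤ C ∧ ∀ ξ, ‖A ξ‖ ≤ C * (1 + ‖ξ‖) ^ m

/-- `α ∈ (0, 2]` is the Sobolev index of the symbol `A`. -/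
def HasSobolevIndex {d : ℕ} (A : Rd d → ℂ) (α : ℝ) : Prop :=
  0 < α ∧ α ≤ 2 ∧ ∃ C₁ C₂ C₃ β : ℝ, 0 ≤ C₁ ∧ 0 < C₂ ∧ 0 ≤ C₃ ∧ 0 ≤ β ∧ β < α ∧
    (∀ ξ, ‖A ξ‖ ≤ C₁ * (1 + ‖ξ‖ ^ 2) ^ (α / 2)) ∧
    (∀ ξ, C₂ * ‖ξ‖ ^ α - C₃ * (1 + ‖ξ‖ ^ 2) ^ (β / 2) ≤ (A ξ).re)

theorem HasSobolevIndex.isSymbol {d : ℕ} {A : Rd d → ℂ} {α : ℝ} (h : HasSobolevIndex A α)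
    (hA : Measurable A) : IsSymbol α A := by
  obtain ⟨hα, -, C₁, -, -, -, hC₁, -, -, -, -, hb, -⟩ := h
  refine ⟨hA, C₁, hC₁, fun ξ ↦ (hb ξ).trans ?_⟩
  have hn := norm_nonneg ξ
  have e : (1 + ‖ξ‖) ^ α = ((1 + ‖ξ‖) ^ 2) ^ (α / 2) := by
    rw [← Real.rpow_natCast_mul (by positivity)]
    congr 1
    push_cast
    ring
  rw [e]
  gcongr
  nlinarith

/-- The bounded function `A(ξ) (1 + |ξ|)⁻ᵐ`. -/
theorem IsSymbol.memLp_top {d : ℕ} {m : ℝ} {A : Rd d → ℂ} (hA : IsSymbol m A) :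
    MemLp (fun ξ ↦ A ξ * (weight (-m) ξ : ℂ)) ∞ volume := by
  obtain ⟨hm, C, hC, hb⟩ := hA
  refine memLp_top_of_bound (hm.aestronglyMeasurable.mul
    (Complex.continuous_ofReal.comp (continuous_weight (-m))).aestronglyMeasurable) C
    (.of_forall fun ξ ↦ ?_)
  have h1 := weight_mul_neg m ξ
  have h2 := weight_pos (-m) ξ
  rw [norm_mul, Complex.norm_real, Real.norm_of_nonneg h2.le]
  calc ‖A ξ‖ * weight (-m) ξ ≤ C * weight m ξ * weight (-m) ξ := by
        gcongr
        exact hb ξ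
    _ = C := by rw [mul_assoc, h1, mul_one]

/-- The pseudo-differential operator `𝓐 : Hˢ(ℝᵈ) → Hˢ⁻ᵐ(ℝᵈ)` with symbol `A ∈ S⁰ₘ`: the continuous
linear operator that multiplies the Fourier transform by `A`, see `hat_pdo`. On Schwartz functions
it is `(𝓐 φ)(x) = (2π)⁻ᵈ ∫ A(ξ) φ̂(ξ) e^{-i⟨x,ξ⟩} dξ`, see `pdo_schwartz`. -/
def pdo {d : ℕ} {m : ℝ} {A : Rd d → ℂ} (hA : IsSymbol m A) (s : ℝ) : Hs d s →L[ℂ] Hs d (s - m) :=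
  ((Hs.equivL2 d (s - m)).symm.toContinuousLinearEquiv : _ →L[ℂ] Hs d (s - m)) ∘L
    ((ContinuousLinearMap.lsmul ℂ ℂ : ℂ →L[ℂ] ℂ →L[ℂ] ℂ).holderL volume ∞ 2 2
      hA.memLp_top.toLp) ∘L
    ((Hs.equivL2 d s).toContinuousLinearEquiv : Hs d s →L[ℂ] _)

theorem hat_pdo {d : ℕ} {m s : ℝ} {A : Rd d → ℂ} (hA : IsSymbol m A) (u : Hs d s) :
    Hs.hat (pdo hA s u) =ᵐ[volume] fun ξ ↦ A ξ * Hs.hat u ξ := by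
  have e : Hs.equivL2 d (s - m) (pdo hA s u) =
      (ContinuousLinearMap.lsmul ℂ ℂ : ℂ →L[ℂ] ℂ →L[ℂ] ℂ).holder 2
        hA.memLp_top.toLp (Hs.equivL2 d s u) := by
    simp [pdo]
  have h1 := Hs.coeFn_equivL2 (pdo hA s u)
  rw [e] at h1
  filter_upwards [h1, ContinuousLinearMap.coeFn_holder (r := 2)
    (ContinuousLinearMap.lsmul ℂ ℂ : ℂ →L[ℂ] ℂ →L[ℂ] ℂ) hA.memLp_top.toLp (Hs.equivL2 d s u),
    Hs.coeFn_equivL2 u, hA.memLp_top.coeFn_toLp] with ξ h1 h2 h3 h4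
  rw [h2, h3, h4] at h1
  have hw : (weight (s - m) ξ : ℂ) ≠ 0 := by exact_mod_cast (weight_pos (s - m) ξ).ne'
  apply mul_left_cancel₀ hw
  rw [← h1, ContinuousLinearMap.lsmul_apply, smul_eq_mul, sub_eq_add_neg, ← weight_mul]
  push_cast
  ring

/-- On Schwartz functions the operator `pdo` is given by the integral formula. -/
theorem pdo_schwartz {d : ℕ} {m s : ℝ} {A : Rd d → ℂ} (hA : IsSymbol m A) (φ : 𝓢(Rd d, ℂ))
    (u : Hs d s) (hu : Hs.toDist u = (φ : 𝓢'(Rd d, ℂ))) (ψ : 𝓢(Rd d, ℂ)) :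
    Hs.toDist (pdo hA s u) ψ = ∫ x, ψ x * (((2 * (Real.pi : ℂ)) ^ d)⁻¹ *
      ∫ ξ, A ξ * fourierS d φ ξ * Complex.exp (-Complex.I * (inner ℝ x ξ : ℝ))) := by
  have hφ : Hs.hat u =ᵐ[volume] fourierS d φ :=
    (Hs.hasFourierTransform_hat u).unique (hu ▸ hasFourierTransform_schwartz φ)
  have hh : HasFourierTransform (Hs.toDist (pdo hA s u)) (fun ξ ↦ A ξ * fourierS d φ ξ) := by
    refine (Hs.hasFourierTransform_hat _).congr ((hat_pdo hA u).trans ?_)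
    filter_upwards [hφ] with ξ hξ
    rw [hξ]
  have hint : Integrable (fun ξ ↦ A ξ * fourierS d φ ξ) := by
    obtain ⟨k, hk⟩ := exists_nat_ge m
    obtain ⟨hm, C, hC, hb⟩ := hA
    have h0 : Integrable (fun ξ ↦ (2 ^ k : ℝ) * (‖fourierS d φ ξ‖ +
        ‖ξ‖ ^ k * ‖fourierS d φ ξ‖)) :=
      (((fourierS d φ).integrable (μ := volume)).norm.add
        ((fourierS d φ).integrable_pow_mul volume k)).const_mul (2 ^ k : ℝ)
    refine (h0.const_mul C).mono'
      (hm.aestronglyMeasurable.mul (fourierS d φ).continuous.aestronglyMeasurable)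
      (.of_forall fun ξ ↦ ?_)
    have hn := norm_nonneg ξ
    have h1 : (1 + ‖ξ‖) ^ m ≤ 2 ^ k * (1 + ‖ξ‖ ^ k) := by
      calc (1 + ‖ξ‖) ^ m ≤ (1 + ‖ξ‖) ^ (k : ℝ) :=
            Real.rpow_le_rpow_of_exponent_le (by linarith) hk
        _ = (1 + ‖ξ‖) ^ k := Real.rpow_natCast _ _
        _ ≤ 2 ^ k * (1 + ‖ξ‖ ^ k) := by
          rcases le_total ‖ξ‖ 1 with h | h
          · calc (1 + ‖ξ‖) ^ k ≤ 2 ^ k := by gcongr; linarith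
              _ ≤ _ := le_mul_of_one_le_right (by positivity) (by linarith [pow_nonneg hn k])
          · calc (1 + ‖ξ‖) ^ k ≤ (2 * ‖ξ‖) ^ k := by gcongr; linarith
              _ = 2 ^ k * ‖ξ‖ ^ k := mul_pow _ _ _
              _ ≤ _ := by gcongr; linarith
    rw [norm_mul]
    calc ‖A ξ‖ * ‖fourierS d φ ξ‖ ≤ C * (2 ^ k * (1 + ‖ξ‖ ^ k)) * ‖fourierS d φ ξ‖ := by
          gcongr
          exact (hb ξ).trans (by gcongr)
      _ = _ := by ring
  obtain ⟨ψ₀, rfl⟩ := (fourierS d).surjective ψ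
  rw [(hh.2 ψ₀).2]
  have key := integral_kernel_flip (-1) ((fourierS d ψ₀).integrable (μ := volume)) hint
  have e1 : ∀ ξ, ψ₀ ξ * (A ξ * fourierS d φ ξ) = (((2 * Real.pi) ^ d)⁻¹ : ℂ) *
      ((∫ x, Complex.exp (Complex.I * (-1 * inner ℝ ξ x : ℝ)) * fourierS d ψ₀ x) *
        (A ξ * fourierS d φ ξ)) := fun ξ ↦ by
    rw [fourierS_inversion ψ₀ ξ, mul_assoc]
    simp
  simp_rw [e1]
  rw [integral_const_mul, key, ← integral_const_mul]
  refine integral_congr_ae (.of_forall fun x ↦ ?_)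
  simp only
  rw [mul_left_comm]
  congr 2
  refine integral_congr_ae (.of_forall fun ξ ↦ ?_)
  simp only
  rw [mul_comm]
  congr 2
  push_cast
  ring

/-! ### The parabolic problem -/

/-- The Lebesgue–Bochner space `L²(0, T; X)`. -/
abbrev L2Time (T : ℝ) (X : Type) [NormedAddCommGroup X] : Type :=
  Lp X 2 ((volume : Measure ℝ).restrict (Set.Ioo 0 T))

/-- `w ∈ L²(0, T; Hʳ)` is the derivative of `u ∈ L²(0, T; Hˢ)` in the sense of distributions on
`(0, T)`: `∫₀ᵀ η'(t) u(t) dt = - ∫₀ᵀ η(t) w(t) dt` for every test function `η ∈ C_c^∞((0, T))`. -/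
def HasTimeDeriv {d : ℕ} {T s r : ℝ} (u : L2Time T (Hs d s)) (w : L2Time T (Hs d r)) : Prop :=
  ∀ η : ℝ → ℝ, ContDiff ℝ ∞ η → HasCompactSupport η → tsupport η ⊆ Set.Ioo 0 T →
    Hs.toDist (∫ t in Set.Ioo 0 T, deriv η t • u t) = -Hs.toDist (∫ t in Set.Ioo 0 T, η t • w t)

/-- The space `W¹(0, T; Hˢ(ℝᵈ), L²(ℝᵈ))` of the `u ∈ L²(0, T; Hˢ)` with a derivative
`∂ₜu ∈ L²(0, T; H⁻ˢ)`, where `H⁻ˢ` is the dual of `Hˢ` with respect to the pivot space `L²`. -/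
def W1 (d : ℕ) (T s : ℝ) : Set (L2Time T (Hs d s)) :=
  {u | ∃ w : L2Time T (Hs d (-s)), HasTimeDeriv u w}

/-- The initial condition `u(0) = g`: the function `u` has a representative that is continuous
on `[0, T]` with values in `L²(ℝᵈ)`, and this representative takes the value `g` at `0`. -/
def HasInitialValue {d : ℕ} {T s : ℝ} (u : L2Time T (Hs d s))
    (g : Lp ℂ 2 (volume : Measure (Rd d))) : Prop :=
  ∃ v : ℝ → Lp ℂ 2 (volume : Measure (Rd d)), ContinuousOn v (Set.Icc 0 T) ∧
    (∀ᵐ t ∂(volume : Measure ℝ).restrict (Set.Ioo 0 T),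
      Hs.toDist (u t) = Lp.toTemperedDistribution (v t)) ∧
    v 0 = g

/-- `u ∈ L²(0, T; H^(α/2))` is a weak solution of `∂ₜu + 𝓐u = f`, `u(0) = g`, where `𝓐` is the
pseudo-differential operator with symbol `A ∈ S⁰_α`: the distributional derivative `∂ₜu` exists in
`L²(0, T; H^(-α/2))`, the equation holds in `H^(-α/2)` for almost every `t ∈ (0, T)`, and
`u(0) = g`. -/
def IsWeakSolution {d : ℕ} {T α : ℝ} {A : Rd d → ℂ} (hA : IsSymbol α A)
    (f : L2Time T (Hs d (-(α / 2)))) (g : Lp ℂ 2 (volume : Measure (Rd d)))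
    (u : L2Time T (Hs d (α / 2))) : Prop :=
  (∃ w : L2Time T (Hs d (-(α / 2))), HasTimeDeriv u w ∧
    ∀ᵐ t ∂(volume : Measure ℝ).restrict (Set.Ioo 0 T),
      Hs.toDist (w t) + Hs.toDist (pdo hA (α / 2) (u t)) = Hs.toDist (f t)) ∧
  HasInitialValue u g

end SobolevIndex

end

noncomputable section

namespace SobolevIndex

open Set Filter

open scoped Topology InnerProductSpace BoundedContinuousFunction

/-! ### Continuous functions with vanishing weak derivative -/

section DuBoisReymond

variable {E : Type*} [NormedAddCommGroup E] [NormedSpace ℝ E]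

/-- A smooth function supported in a bounded interval whose integral vanishes has a primitive
supported in the same interval. -/
theorem exists_primitive_of_integral_eq_zero {a b : ℝ} {ψ : ℝ → ℝ} (hψ : ContDiff ℝ ∞ ψ)
    (hc : HasCompactSupport ψ) (hs : tsupport ψ ⊆ Ioo a b) (h0 : ∫ t in Ioo a b, ψ t = 0) :
    ∃ η : ℝ → ℝ, ContDiff ℝ ∞ η ∧ HasCompactSupport η ∧ tsupport η ⊆ Ioo a b ∧ deriv η = ψ := by
  rcases eq_empty_or_nonempty (tsupport ψ) with he | hne
  · have : ψ = 0 := by rwa [tsupport_eq_empty_iff] at he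
    exact ⟨0, contDiff_const, HasCompactSupport.zero, by simp [tsupport_eq_empty_iff.2 rfl],
      by rw [this]; ext; simp⟩
  -- The extreme points of the support lie strictly inside `(a, b)`, so it suffices that the
  -- primitive starting at `a` vanishes off `[p, q]`.
  obtain ⟨p, hp⟩ := hc.isCompact.exists_isLeast hne
  obtain ⟨q, hq⟩ := hc.isCompact.exists_isGreatest hne
  have hap : a < p := (hs hp.1).1
  have hqb : q < b := (hs hq.1).2
  have hpq : p ≤ q := hp.2 hq.1
  have hz1 : ∀ t, t < p → ψ t = 0 := fun t ht ↦
    image_eq_zero_of_notMem_tsupport fun h ↦ absurd (hp.2 h) (not_le.2 ht)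
  have hz2 : ∀ t, q < t → ψ t = 0 := fun t ht ↦
    image_eq_zero_of_notMem_tsupport fun h ↦ absurd (hq.2 h) (not_le.2 ht)
  have hder : ∀ t, HasDerivAt (fun t ↦ ∫ s in a..t, ψ s) (ψ t) t := fun t ↦
    (hψ.continuous.integral_hasStrictDerivAt a t).hasDerivAt
  have hd : deriv (fun t ↦ ∫ s in a..t, ψ s) = ψ := funext fun t ↦ (hder t).deriv
  have hab : a ≤ b := by linarith
  have hint : ∫ s in a..b, ψ s = 0 := by
    rw [intervalIntegral.integral_of_le hab, integral_Ioc_eq_integral_Ioo, h0]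
  have hsupp : Function.support (fun t ↦ ∫ s in a..t, ψ s) ⊆ Icc p q := by
    intro t ht
    by_contra hn
    apply ht
    rw [mem_Icc, not_and_or, not_le, not_le] at hn
    simp only
    rcases hn with hn | hn
    · refine intervalIntegral.integral_zero_ae (.of_forall fun s hs ↦ hz1 s ?_)
      rcases le_total a t with h | h
      · rw [uIoc_of_le h] at hs; linarith [hs.2]
      · rw [uIoc_of_ge h] at hs; linarith [hs.2]
    -- To the right of `q` the primitive equals the total integral, which is zero.
    · have h2 : ∫ s in t..b, ψ s = 0 := by
        refine intervalIntegral.integral_zero_ae (.of_forall fun s hs ↦ hz2 s ?_)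
        rcases le_total t b with h | h
        · rw [uIoc_of_le h] at hs; linarith [hs.1]
        · rw [uIoc_of_ge h] at hs; linarith [hs.1]
      have h3 := intervalIntegral.integral_add_adjacent_intervals
        (hψ.continuous.intervalIntegrable a t) (hψ.continuous.intervalIntegrable t b) (μ := volume)
      rw [h2, hint, add_zero] at h3
      exact h3
  have hts : tsupport (fun t ↦ ∫ s in a..t, ψ s) ⊆ Icc p q :=
    closure_minimal hsupp isClosed_Icc
  refine ⟨_, ?_, HasCompactSupport.of_support_subset_isCompact isCompact_Icc hsupp,
    hts.trans (Icc_subset_Ioo hap hqb), hd⟩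
  rw [contDiff_infty_iff_deriv, hd]
  exact ⟨fun t ↦ (hder t).differentiableAt, hψ⟩

variable [CompleteSpace E]

/-- The du Bois-Reymond lemma: a continuous function with vanishing weak derivative is constant. -/
theorem eq_left_of_integral_deriv_smul_eq_zero {a b : ℝ} (hab : a < b) {z : ℝ → E}
    (hz : ContinuousOn z (Icc a b))
    (h : ∀ η : ℝ → ℝ, ContDiff ℝ ∞ η → HasCompactSupport η → tsupport η ⊆ Ioo a b →
      ∫ t in Ioo a b, deriv η t • z t = 0) {t : ℝ} (ht : t ∈ Icc a b) : z t = z a := by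
  have hzi : IntegrableOn z (Ioo a b) :=
    (hz.integrableOn_compact isCompact_Icc).mono_set Ioo_subset_Icc_self
  have hmul : ∀ φ : ℝ → ℝ, Continuous φ → IntegrableOn (fun t ↦ φ t • z t) (Ioo a b) :=
    fun φ hφ ↦ ((hφ.continuousOn.smul hz).integrableOn_compact isCompact_Icc).mono_set
      Ioo_subset_Icc_self
  -- A bump around the midpoint; the outer radius `(b - a) / 4` keeps its closed support inside `(a,
  -- b)`. The constant value of `z` will be its average `c` against the normalized bump.
  let B : ContDiffBump ((a + b) / 2) := ⟨(b - a) / 8, (b - a) / 4, by linarith, by linarith⟩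
  have hBs : tsupport (B.normed volume) ⊆ Ioo a b := by
    rw [B.tsupport_normed_eq, Real.closedBall_eq_Icc]
    intro x hx
    have h4 : B.rOut = (b - a) / 4 := rfl
    rw [h4] at hx
    constructor <;> linarith [hx.1, hx.2]
  have hBI : ∫ t in Ioo a b, B.normed volume t = 1 := by
    rw [setIntegral_eq_integral_of_forall_compl_eq_zero, B.integral_normed]
    intro x hx
    exact image_eq_zero_of_notMem_tsupport fun h' ↦ hx (hBs h')
  have hBc : ContDiff ℝ ∞ (B.normed volume) := B.contDiff_normed
  have hBint : IntegrableOn (B.normed volume) (Ioo a b) := B.integrable_normed.integrableOn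
  set c : E := ∫ t in Ioo a b, B.normed volume t • z t with hcdef
  -- Subtracting from `φ` the multiple `k = ∫ φ` of the normalized bump leaves mean zero, hence the
  -- derivative of a test function. The hypothesis then reads `∫ φ z = k c = ∫ φ c`.
  have key : ∀ φ : ℝ → ℝ, ContDiff ℝ ∞ φ → HasCompactSupport φ → tsupport φ ⊆ Ioo a b →
      ∫ t, φ t • (indicator (Ioo a b) (fun t ↦ z t - c)) t = 0 := by
    intro φ hφ hφc hφs
    have hφi : IntegrableOn φ (Ioo a b) :=
      (hφ.continuous.integrable_of_hasCompactSupport hφc).integrableOn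
    set k : ℝ := ∫ t in Ioo a b, φ t with hk
    have hts : tsupport (fun t ↦ φ t - k * B.normed volume t) ⊆ Ioo a b := by
      refine (tsupport_sub _ _).trans (union_subset hφs ?_)
      exact (tsupport_mul_subset_right).trans hBs
    obtain ⟨η, e1, e2, e3, e4⟩ := exists_primitive_of_integral_eq_zero (a := a) (b := b)
      (ψ := fun t ↦ φ t - k * B.normed volume t) (by fun_prop)
      (hφc.sub (B.hasCompactSupport_normed.mul_left)) hts (by
        rw [integral_sub hφi (hBint.const_mul k), integral_const_mul, hBI, ← hk]; simp)
    have := h η e1 e2 e3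
    simp only [e4, sub_smul, mul_smul] at this
    have hk2 : IntegrableOn (fun t ↦ k • B.normed volume t • z t) (Ioo a b) :=
      (hmul _ hBc.continuous).smul k
    rw [integral_sub (hmul φ hφ.continuous) hk2, integral_smul,
      ← hcdef, hk, ← integral_smul_const, ← integral_sub (hmul φ hφ.continuous)
        (hφi.smul_const c)] at this
    simp only [← smul_sub] at this
    rw [← this, ← integral_indicator measurableSet_Ioo]
    congr 1
    ext t
    by_cases ht : t ∈ Ioo a b <;> simp [ht]
  have hae := isOpen_Ioo.ae_eq_zero_of_integral_contDiff_smul_eq_zero (μ := volume)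
    (f := indicator (Ioo a b) (fun t ↦ z t - c)) (U := Ioo a b) (by
      apply IntegrableOn.locallyIntegrableOn
      refine IntegrableOn.congr_fun (f := fun t ↦ z t - c) ?_ ?_ measurableSet_Ioo
      · exact hzi.sub (integrableOn_const (by simp))
      · intro t ht; simp [ht]) key
  have hEq : EqOn z (fun _ ↦ c) (Ioo a b) := by
    refine Measure.eqOn_open_of_ae_eq (μ := volume) ?_ isOpen_Ioo (hz.mono Ioo_subset_Icc_self)
      continuousOn_const
    rw [Filter.EventuallyEq, ae_restrict_iff' measurableSet_Ioo]
    filter_upwards [hae] with t ht hm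
    have := ht hm
    rw [indicator_of_mem hm] at this
    exact sub_eq_zero.1 this
  have hEq' : EqOn z (fun _ ↦ c) (Icc a b) := by
    refine hEq.of_subset_closure hz continuousOn_const Ioo_subset_Icc_self ?_
    rw [closure_Ioo hab.ne]
  rw [hEq' ht, hEq' (left_mem_Icc.2 hab.le)]

end DuBoisReymond

/-! ### Integration by parts and linear differential equations -/

section Calculus

variable {E : Type*} [NormedAddCommGroup E] [NormedSpace ℝ E] [CompleteSpace E]

/-- Integration by parts against a test function. -/
theorem integral_deriv_smul_eq_neg {T : ℝ} (hT : 0 < T) {η : ℝ → ℝ} (hη : ContDiff ℝ ∞ η)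
    (hs : tsupport η ⊆ Ioo 0 T) {V D : ℝ → E} (hV : ∀ t, HasDerivAt V (D t) t)
    (hD : Continuous D) :
    ∫ t in Ioo 0 T, deriv η t • V t = -∫ t in Ioo 0 T, η t • D t := by
  have h0 : η 0 = 0 := image_eq_zero_of_notMem_tsupport fun h ↦ (lt_irrefl _ (hs h).1)
  have h1 : η T = 0 := image_eq_zero_of_notMem_tsupport fun h ↦ (lt_irrefl _ (hs h).2)
  have hd : Continuous (deriv η) := hη.continuous_deriv (by simp)
  have := intervalIntegral.integral_smul_deriv_eq_deriv_smul (a := 0) (b := T) (u := η)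
    (u' := deriv η) (v := V) (v' := D)
    (fun x _ ↦ (hη.differentiable (by simp)).differentiableAt.hasDerivAt) (fun x _ ↦ hV x)
    (hd.intervalIntegrable _ _) (hD.intervalIntegrable _ _)
  rw [h0, h1, zero_smul, zero_smul, sub_zero, zero_sub, intervalIntegral.integral_of_le hT.le,
    intervalIntegral.integral_of_le hT.le, integral_Ioc_eq_integral_Ioo,
    integral_Ioc_eq_integral_Ioo] at this
  rw [this, neg_neg]

/-- The inhomogeneous linear differential equation `v' = -L v + h`. -/
theorem exists_hasDerivAt_linear (L : E →L[ℝ] E) {h : ℝ → E} (hh : Continuous h) (v₀ : E) :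
    ∃ v : ℝ → E, v 0 = v₀ ∧ ∀ t, HasDerivAt v (-(L (v t)) + h t) t := by
  let S : ℝ → E →L[ℝ] E := fun t ↦ NormedSpace.exp (t • L)
  have hS : ∀ t, HasDerivAt S (L * S t) t := fun t ↦ hasDerivAt_exp_smul_const' L t
  have hSc : Continuous S := continuous_iff_continuousAt.2 fun t ↦ (hS t).continuousAt
  have hS0 : S 0 = 1 := by simp [S]
  have hinv : ∀ t, S (-t) * S t = 1 := fun t ↦ by
    simp only [S, neg_smul]
    -- The addition formula for the exponential uses a `ℚ`-algebra structure.
    let _ : NormedAlgebra ℚ (E →L[ℝ] E) := NormedAlgebra.restrictScalars ℚ ℝ _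
    rw [← NormedSpace.exp_add_of_commute (Commute.neg_left (Commute.refl (t • L))), neg_add_cancel,
      NormedSpace.exp_zero]
  have hneg : ∀ t, HasDerivAt (fun t ↦ S (-t)) (-(L * S (-t))) t := fun t ↦ by
    have := (hS (-t)).scomp t (hasDerivAt_neg t)
    rwa [neg_one_smul] at this
  have hc : Continuous fun s ↦ S s (h s) := hSc.clm_apply hh
  -- Variation of constants, with the factor `S (-t)` taken out of the integral.
  refine ⟨fun t ↦ S (-t) (v₀ + ∫ s in (0 : ℝ)..t, S s (h s)), by simp [hS0], fun t ↦ ?_⟩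
  have hI : HasDerivAt (fun t ↦ v₀ + ∫ s in (0 : ℝ)..t, S s (h s)) (S t (h t)) t :=
    ((hc.integral_hasStrictDerivAt 0 t).hasDerivAt).const_add v₀
  have := (hneg t).clm_apply hI
  convert this using 1
  have e : S (-t) (S t (h t)) = h t := by
    rw [← mul_apply_eq_comp, hinv]; rfl
  rw [e]
  simp

end Calculus

/-! ### The degenerate Cauchy problem: cutoffs and uniqueness -/

section Abstract

variable {X : Type} [NormedAddCommGroup X] [InnerProductSpace ℂ X]

/-- Cutoffs `P n` reducing the operators `N`, `B`, such that `N` has the inverse `R n` on the range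
of `P n`. -/
structure IsCutoff (N B : X →L[ℂ] X) (P R : ℕ → X →L[ℂ] X) : Prop where
  apply_right : ∀ n x, N (R n x) = P n x
  apply_left : ∀ n x, R n (N x) = P n x
  proj_right : ∀ n x, R n (P n x) = R n x
  proj_left : ∀ n x, P n (R n x) = R n x
  comm : ∀ n x, P n (B x) = B (P n x)
  norm_le : ∀ n x, ‖P n x‖ ≤ ‖x‖
  tendsto : ∀ x, Tendsto (fun n ↦ P n x) atTop (𝓝 x)

/-- Weak solutions of `(N² U)' + B U = F`, `(N U)(0) = g`. -/
def IsDegenerateSolution {T : ℝ} (N B : X →L[ℂ] X) (F : L2Time T X) (g : X) (U : L2Time T X) :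
    Prop :=
  (∃ v : ℝ → X, ContinuousOn v (Icc 0 T) ∧
    (∀ᵐ t ∂(volume : Measure ℝ).restrict (Ioo 0 T), N (U t) = v t) ∧ v 0 = g) ∧
  ∀ η : ℝ → ℝ, ContDiff ℝ ∞ η → HasCompactSupport η → tsupport η ⊆ Ioo 0 T →
    N (N (∫ t in Ioo 0 T, deriv η t • U t)) = -∫ t in Ioo 0 T, η t • (F t - B (U t))

theorem integrable_smul_of_continuous {T : ℝ} {φ : ℝ → ℝ} (hφ : Continuous φ) {U : ℝ → X}
    (hU : MemLp U 2 ((volume : Measure ℝ).restrict (Ioo 0 T))) :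
    IntegrableOn (fun t ↦ φ t • U t) (Ioo 0 T) := by
  have h1 : IntegrableOn U (Icc 0 T) := by
    rw [integrableOn_Icc_iff_integrableOn_Ioo]
    exact hU.integrable one_le_two
  exact (h1.continuousOn_smul hφ.continuousOn isCompact_Icc).mono_set Ioo_subset_Icc_self

/-- `P n x = R n (N x)` tends to `x`, so `N` is injective although no bounded inverse is assumed. -/
theorem IsCutoff.eq_zero {N B : X →L[ℂ] X} {P R : ℕ → X →L[ℂ] X} (h : IsCutoff N B P R) {x : X}
    (hx : N x = 0) : x = 0 := by
  refine tendsto_nhds_unique (h.tendsto x) ?_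
  simp only [← h.apply_left, hx, map_zero]
  exact tendsto_const_nhds

/-- The difference of two solutions solves the homogeneous problem. -/
theorem IsDegenerateSolution.sub {T : ℝ} {N B : X →L[ℂ] X} {F : L2Time T X} {g : X}
    {U₁ U₂ : L2Time T X} (h₁ : IsDegenerateSolution N B F g U₁)
    (h₂ : IsDegenerateSolution N B F g U₂) : IsDegenerateSolution N B 0 0 (U₁ - U₂) := by
  obtain ⟨⟨v₁, hv₁, hN₁, h0₁⟩, hw₁⟩ := h₁
  obtain ⟨⟨v₂, hv₂, hN₂, h0₂⟩, hw₂⟩ := h₂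
  refine ⟨⟨v₁ - v₂, hv₁.sub hv₂, ?_, by simp [h0₁, h0₂]⟩, fun η a b c ↦ ?_⟩
  · filter_upwards [hN₁, hN₂, Lp.coeFn_sub U₁ U₂] with t t1 t2 t3
    rw [t3, Pi.sub_apply, Pi.sub_apply, map_sub, t1, t2]
  · have hd : Continuous (deriv η) := a.continuous_deriv (by simp)
    have hi : ∀ U : L2Time T X, IntegrableOn (fun t ↦ η t • (F t - B (U t))) (Ioo 0 T) :=
      fun U ↦ integrable_smul_of_continuous a.continuous
        ((Lp.memLp F).sub (B.comp_memLp' (Lp.memLp U)))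
    have e1 : ∫ t in Ioo 0 T, deriv η t • (U₁ - U₂ : L2Time T X) t =
        (∫ t in Ioo 0 T, deriv η t • U₁ t) - ∫ t in Ioo 0 T, deriv η t • U₂ t := by
      rw [← integral_sub (integrable_smul_of_continuous hd (Lp.memLp U₁))
        (integrable_smul_of_continuous hd (Lp.memLp U₂))]
      refine integral_congr_ae ?_
      filter_upwards [Lp.coeFn_sub U₁ U₂] with t t3
      rw [t3, Pi.sub_apply, smul_sub]
    have e2 : ∫ t in Ioo 0 T, η t • ((0 : L2Time T X) t - B ((U₁ - U₂ : L2Time T X) t)) =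
        (∫ t in Ioo 0 T, η t • (F t - B (U₁ t))) - ∫ t in Ioo 0 T, η t • (F t - B (U₂ t)) := by
      rw [← integral_sub (hi U₁) (hi U₂)]
      refine integral_congr_ae ?_
      filter_upwards [Lp.coeFn_sub U₁ U₂,
        Lp.coeFn_zero X 2 ((volume : Measure ℝ).restrict (Ioo 0 T))] with t t3 t4
      rw [t3, t4, Pi.sub_apply, ← smul_sub, map_sub, Pi.zero_apply]
      congr 1
      abel
    rw [e1, e2, map_sub, map_sub, hw₁ η a b c, hw₂ η a b c]
    abel

variable [CompleteSpace X]

/-- The homogeneous problem has only the trivial solution. -/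
theorem eq_zero_of_isDegenerateSolution {T : ℝ} (hT : 0 < T) {N B : X →L[ℂ] X}
    {P R : ℕ → X →L[ℂ] X} (h : IsCutoff N B P R) {U : L2Time T X}
    (hU : IsDegenerateSolution N B 0 0 U) : U = 0 := by
  obtain ⟨⟨v, hv, hNU, hv0⟩, hw⟩ := hU
  have hPv : ∀ n, ∀ t ∈ Icc 0 T, P n (v t) = 0 := by
    intro n
    -- Applying `R n` to the weak equation yields `y' = -L y` weakly for `y = P n v`. The
    -- representative `v` is extended by its boundary values to make `y` continuous on the whole
    -- line.
    let L : X →L[ℂ] X := R n ∘L B ∘L R n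
    let y : ℝ → X := fun t ↦ P n (IccExtend hT.le ((Icc 0 T).domRestrict v) t)
    have hyc : Continuous y := by
      refine (P n).continuous.comp ?_
      exact (continuousOn_iff_continuous_domRestrict.1 hv).Icc_extend'
    have hy : ∀ t ∈ Icc 0 T, y t = P n (v t) := fun t ht ↦ by
      simp only [y, IccExtend_of_mem _ _ ht, domRestrict_apply]
    have hy0 : y 0 = 0 := by rw [hy 0 (left_mem_Icc.2 hT.le), hv0, map_zero]
    have hLy : Continuous fun t ↦ L (y t) := L.continuous.comp hyc
    let W : ℝ → X := fun t ↦ ∫ s in (0 : ℝ)..t, L (y s)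
    have hW : ∀ t, HasDerivAt W (L (y t)) t := fun t ↦
      (hLy.integral_hasStrictDerivAt 0 t).hasDerivAt
    have hWc : Continuous W := continuous_iff_continuousAt.2 fun t ↦ (hW t).continuousAt
    -- With `W' = L y`, the function `y + W` has vanishing weak derivative.
    have hz : ∀ t ∈ Icc 0 T, y t + W t = y 0 + W 0 := fun t ht ↦ by
      refine eq_left_of_integral_deriv_smul_eq_zero hT (z := fun t ↦ y t + W t)
        (hyc.add hWc).continuousOn ?_ ht
      intro η h1 h2 h3
      have hdη : Continuous (deriv η) := h1.continuous_deriv (by simp)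
      have hi : ∀ {φ : ℝ → ℝ} {z : ℝ → X}, Continuous φ → Continuous z →
          IntegrableOn (fun t ↦ φ t • z t) (Ioo 0 T) := fun hφ hz ↦
        ((hφ.smul hz).continuousOn.integrableOn_compact isCompact_Icc).mono_set Ioo_subset_Icc_self
      simp only [smul_add]
      rw [integral_add (hi hdη hyc) (hi hdη hWc), integral_deriv_smul_eq_neg hT h1 h3 hW hLy]
      have hUi := integrable_smul_of_continuous hdη (Lp.memLp U)
      have hBi : IntegrableOn (fun t ↦ η t • ((0 : L2Time T X) t - B (U t))) (Ioo 0 T) :=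
        integrable_smul_of_continuous h1.continuous
        (((Lp.memLp (0 : L2Time T X))).sub (B.comp_memLp' (Lp.memLp U)))
      have h4 := congrArg (R n) (hw η h1 h2 h3)
      rw [h.apply_left, map_neg, ← (R n).integral_comp_comm hBi,
        ← ContinuousLinearMap.comp_apply, ← (P n ∘L N).integral_comp_comm hUi] at h4
      have e1 : ∫ t in Ioo 0 T, (P n ∘L N) (deriv η t • U t) =
          ∫ t in Ioo 0 T, deriv η t • y t := by
        refine integral_congr_ae ?_
        filter_upwards [hNU, ae_restrict_mem measurableSet_Ioo] with t ht hm
        rw [ContinuousLinearMap.map_smul_of_tower, ContinuousLinearMap.comp_apply, ht,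
          hy t (Ioo_subset_Icc_self hm)]
      have e2 : ∫ t in Ioo 0 T, R n (η t • ((0 : L2Time T X) t - B (U t))) =
          -∫ t in Ioo 0 T, η t • L (y t) := by
        rw [← integral_neg]
        refine integral_congr_ae ?_
        filter_upwards [hNU, ae_restrict_mem measurableSet_Ioo,
          Lp.coeFn_zero X 2 ((volume : Measure ℝ).restrict (Ioo 0 T))] with t ht hm h0
        rw [ContinuousLinearMap.map_smul_of_tower, h0, hy t (Ioo_subset_Icc_self hm), ← ht,
          ← smul_neg, Pi.zero_apply, zero_sub, map_neg]
        congr 2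
        simp only [L, ContinuousLinearMap.comp_apply]
        -- `R B R N U = R B P U = R P B U = R B U`: the equation closes up in `y`.
        rw [h.proj_right, h.apply_left, ← h.comm, h.proj_right]
      have h5 : ∫ t in Ioo 0 T, deriv η t • y t = ∫ t in Ioo 0 T, η t • L (y t) := by
        rw [← e1, ← neg_neg (∫ t in Ioo 0 T, η t • L (y t)), ← e2]
        exact h4
      rw [h5, add_neg_cancel]
    have hW0 : W 0 = 0 := intervalIntegral.integral_same
    have hyW : ∀ t ∈ Icc 0 T, y t = -W t := fun t ht ↦ by
      have := hz t ht
      rw [hy0, hW0, add_zero] at this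
      exact eq_neg_of_add_eq_zero_left this
    -- Gronwall: `y = -W` gives `‖W'‖ = ‖L W‖ ≤ ‖L‖ ‖W‖` with `W 0 = 0`.
    have hW' : ∀ t ∈ Icc 0 T, W t = 0 := by
      refine eq_zero_of_abs_deriv_le_mul_abs_self_of_eq_zero_right (K := ‖L‖)
        hWc.continuousOn (fun t _ ↦ (hW t).hasDerivWithinAt) hW0 fun t ht ↦ ?_
      rw [hyW t (Ico_subset_Icc_self ht), map_neg, norm_neg]
      exact L.le_opNorm _
    intro t ht
    rw [← hy t ht, hyW t ht, hW' t ht, neg_zero]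
  refine Lp.eq_zero_iff_ae_eq_zero.2 ?_
  filter_upwards [hNU, ae_restrict_mem measurableSet_Ioo] with t ht hm
  refine h.eq_zero ?_
  rw [ht]
  refine tendsto_nhds_unique (h.tendsto _) ?_
  simp only [hPv _ t (Ioo_subset_Icc_self hm)]
  exact tendsto_const_nhds

theorem IsCutoff.solution_unique {T : ℝ} (hT : 0 < T) {N B : X →L[ℂ] X}
    {P R : ℕ → X →L[ℂ] X} (h : IsCutoff N B P R) {F : L2Time T X} {g : X}
    {U₁ U₂ : L2Time T X} (h₁ : IsDegenerateSolution N B F g U₁)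
    (h₂ : IsDegenerateSolution N B F g U₂) : U₁ = U₂ :=
  sub_eq_zero.1 (eq_zero_of_isDegenerateSolution hT h (h₁.sub h₂))

end Abstract

/-! ### Two convergence tools -/

/-- Dominated convergence in `L²`. -/
theorem tendsto_Lp_two_of_dominated {α E : Type*} [MeasurableSpace α] {μ : Measure α}
    [NormedAddCommGroup E] {f : ℕ → Lp E 2 μ} {g : Lp E 2 μ}
    (hle : ∀ n, ∀ᵐ x ∂μ, ‖f n x‖ ≤ ‖g x‖)
    (hlim : ∀ᵐ x ∂μ, Tendsto (fun n ↦ f n x) atTop (𝓝 (g x))) :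
    Tendsto f atTop (𝓝 g) := by
  rw [Lp.tendsto_Lp_iff_tendsto_eLpNorm']
  have e : ∀ n, eLpNorm (⇑(f n) - ⇑g) 2 μ = (∫⁻ x, ‖f n x - g x‖ₑ ^ (2 : ℝ) ∂μ) ^ (1 / (2 : ℝ)) :=
    fun n ↦ by simp [eLpNorm_eq_lintegral_rpow_enorm_toReal]
  simp_rw [e]
  have h2 : Tendsto (fun n ↦ ∫⁻ x, ‖f n x - g x‖ₑ ^ (2 : ℝ) ∂μ) atTop (𝓝 (∫⁻ _, 0 ∂μ)) := by
    refine tendsto_lintegral_of_dominated_convergence' (fun x ↦ (2 * ‖g x‖ₑ) ^ (2 : ℝ))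
      (fun n ↦ ?_) (fun n ↦ ?_) ?_ ?_
    · exact (((Lp.aestronglyMeasurable (f n)).sub (Lp.aestronglyMeasurable g)).enorm).pow_const _
    · filter_upwards [hle n] with x hx
      refine ENNReal.rpow_le_rpow ?_ (by norm_num)
      refine (enorm_sub_le).trans ?_
      rw [two_mul]
      gcongr
      exact enorm_le_iff_norm_le.2 hx
    · have h3 : eLpNorm (⇑g) 2 μ < ⊤ := Lp.eLpNorm_lt_top g
      simp_rw [ENNReal.mul_rpow_of_nonneg _ _ (zero_le_two (α := ℝ))]
      rw [lintegral_const_mul' _ _ (by simp)]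
      refine ENNReal.mul_ne_top (by simp) ?_
      have h4 := lintegral_rpow_enorm_lt_top_of_eLpNorm_lt_top two_ne_zero ENNReal.ofNat_ne_top h3
      simpa using h4.ne
    · filter_upwards [hlim] with x hx
      have h5 : Tendsto (fun n ↦ ‖f n x - g x‖ₑ) atTop (𝓝 0) := by
        have := (hx.sub_const (g x)).enorm
        simpa using this
      have := (ENNReal.continuous_rpow_const (y := 2)).continuousAt.tendsto.comp h5
      simpa [Function.comp_def] using this
  rw [lintegral_zero] at h2
  have := (ENNReal.continuous_rpow_const (y := 1 / 2)).continuousAt.tendsto.comp h2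
  simpa [Function.comp_def] using this

/-- A bound for the second component by the first passes from a subspace of a product to its
closure, over every point that is approximated by first components. -/
theorem exists_mem_closure_of_bound {𝕜 E G : Type*} [NontriviallyNormedField 𝕜]
    [NormedAddCommGroup E] [NormedSpace 𝕜 E] [NormedAddCommGroup G] [NormedSpace 𝕜 G]
    [CompleteSpace E] [CompleteSpace G] (D : Submodule 𝕜 (E × G)) {K : ℝ}
    (hK : ∀ p ∈ D, ‖p.2‖ ≤ K * ‖p.1‖) {x : E} (hx : x ∈ closure (Prod.fst '' (D : Set (E × G)))) :
    ∃ y, (x, y) ∈ closure (D : Set (E × G)) := by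
  obtain ⟨a, ha, hlim⟩ := mem_closure_iff_seq_limit.1 hx
  choose p hp hpa using ha
  have hc : CauchySeq fun n ↦ (p n).2 := by
    rw [Metric.cauchySeq_iff']
    intro ε hε
    have hca := hlim.cauchySeq
    rw [Metric.cauchySeq_iff'] at hca
    -- `|K| + 1` is positive whatever the sign of `K`. Since `D` is a subspace, the bound applies to
    -- differences and transfers the Cauchy property to the second components.
    obtain ⟨n₀, hn⟩ := hca (ε / (|K| + 1)) (by positivity)
    refine ⟨n₀, fun n h ↦ ?_⟩
    have h1 := hK _ (D.sub_mem (hp n) (hp n₀))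
    have h2 := hn n h
    rw [dist_eq_norm, ← hpa, ← hpa] at h2
    rw [dist_eq_norm]
    rw [Prod.snd_sub, Prod.fst_sub] at h1
    rw [lt_div_iff₀ (by positivity)] at h2
    have h3 := le_abs_self K
    have h4 := norm_nonneg ((p n).1 - (p n₀).1)
    nlinarith
  obtain ⟨y, hy⟩ := cauchySeq_tendsto_of_complete hc
  refine ⟨y, mem_closure_iff_seq_limit.2 ⟨p, hp, ?_⟩⟩
  exact (hlim.congr fun n ↦ (hpa n).symm).prodMk_nhds hy

/-! ### The energy estimate -/

section Energy

variable {X : Type} [NormedAddCommGroup X] [InnerProductSpace ℂ X]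

/-- The energy estimate for classical solutions of `N² V' + B V = f`. -/
theorem energy_estimate {T : ℝ} {N B : X →L[ℂ] X}
    (hN : ∀ x y, ⟪N x, y⟫_ℂ = ⟪x, N y⟫_ℂ) {c l : ℝ} (hc : 0 < c) (hl : 0 ≤ l)
    (hB : ∀ x, c * ‖x‖ ^ 2 - l * ‖N x‖ ^ 2 ≤ (⟪x, B x⟫_ℂ).re) {V D f : ℝ → X}
    (hV : ∀ t, HasDerivAt V (D t) t) (hf : Continuous f)
    (hD : ∀ t, N (N (D t)) = f t - B (V t)) {t : ℝ} (ht : t ∈ Icc 0 T) :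
    Real.exp (-(2 * l * T)) * ‖N (V t)‖ ^ 2 +
      c * Real.exp (-(2 * l * T)) * ∫ s in (0 : ℝ)..t, ‖V s‖ ^ 2 ≤
      ‖N (V 0)‖ ^ 2 + c⁻¹ * ∫ s in (0 : ℝ)..t, ‖f s‖ ^ 2 := by
  have hVc : Continuous V := continuous_iff_continuousAt.2 fun t ↦ (hV t).continuousAt
  have hE : ∀ t, HasDerivAt (fun t ↦ ‖N (V t)‖ ^ 2)
      (2 * (⟪V t, f t - B (V t)⟫_ℂ).re) t := fun t ↦ by
    have h1 : HasDerivAt (fun t ↦ N (V t)) (N (D t)) t :=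
      ((N.restrictScalars ℝ).hasFDerivAt.comp_hasDerivAt t (hV t))
    -- The squared norm is differentiated through the real inner product, the real part of the
    -- complex one. Symmetry of `N` then produces `N (N (D t))`, which the equation replaces.
    let _ : InnerProductSpace ℝ X := InnerProductSpace.rclikeToReal ℂ X
    have h2 := h1.norm_sq
    rw [real_inner_eq_re_inner ℂ, hN, hD] at h2
    exact h2
  set k := Real.exp (-(2 * l * T)) with hk
  have hk0 : 0 < k := Real.exp_pos _
  -- The exponential weight absorbs the term `2 l ‖N V‖²` from the Gårding inequality. It lies
  -- between `k` and `1` on `[0, T]`, so with these coefficients `G' ≤ 0`.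
  let G : ℝ → ℝ := fun t ↦ Real.exp (-(2 * l * t)) * ‖N (V t)‖ ^ 2 +
    ((c * k * ∫ s in (0 : ℝ)..t, ‖V s‖ ^ 2) - c⁻¹ * ∫ s in (0 : ℝ)..t, ‖f s‖ ^ 2)
  have hG : ∀ t, HasDerivAt G ((-(2 * l) * Real.exp (-(2 * l * t)) * ‖N (V t)‖ ^ 2 +
      Real.exp (-(2 * l * t)) * (2 * (⟪V t, f t - B (V t)⟫_ℂ).re)) +
      (c * k * ‖V t‖ ^ 2 - c⁻¹ * ‖f t‖ ^ 2)) t := fun t ↦ by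
    have h1 : HasDerivAt (fun t ↦ Real.exp (-(2 * l * t)))
        (-(2 * l) * Real.exp (-(2 * l * t))) t := by
      have := (((hasDerivAt_id t).const_mul (2 * l)).neg).exp
      simpa [mul_comm] using this
    have h2 : HasDerivAt (fun t ↦ ∫ s in (0 : ℝ)..t, ‖V s‖ ^ 2) (‖V t‖ ^ 2) t :=
      ((hVc.norm.pow 2).integral_hasStrictDerivAt 0 t).hasDerivAt
    have h3 : HasDerivAt (fun t ↦ ∫ s in (0 : ℝ)..t, ‖f s‖ ^ 2) (‖f t‖ ^ 2) t :=
      ((hf.norm.pow 2).integral_hasStrictDerivAt 0 t).hasDerivAt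
    exact (h1.mul (hE t)).add ((h2.const_mul (c * k)).sub (h3.const_mul c⁻¹))
  have hGle : ∀ t ∈ Icc 0 T, G t ≤ G 0 := by
    have : AntitoneOn G (Icc 0 T) := by
      refine antitoneOn_of_deriv_nonpos (convex_Icc 0 T)
        (fun t _ ↦ (hG t).continuousAt.continuousWithinAt)
        (fun t _ ↦ (hG t).differentiableAt.differentiableWithinAt) fun t ht ↦ ?_
      rw [interior_Icc] at ht
      rw [(hG t).deriv]
      have hkt : k ≤ Real.exp (-(2 * l * t)) := by
        rw [hk]
        gcongr
        exact ht.2.le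
      have hkt1 : Real.exp (-(2 * l * t)) ≤ 1 := by
        rw [Real.exp_le_one_iff]
        have := mul_nonneg hl ht.1.le
        linarith
      set m := Real.exp (-(2 * l * t)) with hm
      have hm0 : 0 < m := Real.exp_pos _
      have h1 : (⟪V t, f t - B (V t)⟫_ℂ).re ≤
          ‖V t‖ * ‖f t‖ - c * ‖V t‖ ^ 2 + l * ‖N (V t)‖ ^ 2 := by
        rw [inner_sub_right, Complex.sub_re]
        have := hB (V t)
        have := (Complex.re_le_norm _).trans (norm_inner_le_norm (𝕜 := ℂ) (V t) (f t))
        linarith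
      -- Young's inequality, using up half of the coercive term `2 c ‖V‖²`.
      have h2 : 2 * (‖V t‖ * ‖f t‖) ≤ c * ‖V t‖ ^ 2 + c⁻¹ * ‖f t‖ ^ 2 := by
        have h3 : 0 ≤ c⁻¹ * (c * ‖V t‖ - ‖f t‖) ^ 2 := by positivity
        have h4 : c⁻¹ * (c * ‖V t‖ - ‖f t‖) ^ 2 =
            c * ‖V t‖ ^ 2 + c⁻¹ * ‖f t‖ ^ 2 - 2 * (‖V t‖ * ‖f t‖) := by
          field_simp
          ring
        linarith
      have h5 : m * (2 * (⟪V t, f t - B (V t)⟫_ℂ).re) ≤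
          m * (c⁻¹ * ‖f t‖ ^ 2 - c * ‖V t‖ ^ 2 + 2 * l * ‖N (V t)‖ ^ 2) := by
        gcongr
        linarith
      have h6 : m * (c⁻¹ * ‖f t‖ ^ 2) ≤ 1 * (c⁻¹ * ‖f t‖ ^ 2) := by gcongr
      have h7 : k * (c * ‖V t‖ ^ 2) ≤ m * (c * ‖V t‖ ^ 2) := by gcongr
      linarith
    intro t ht
    exact this (left_mem_Icc.2 (ht.1.trans ht.2)) ht ht.1
  have h0 : G 0 = ‖N (V 0)‖ ^ 2 := by simp [G]
  have h1 := hGle t ht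
  rw [h0] at h1
  have h2 : k * ‖N (V t)‖ ^ 2 ≤ Real.exp (-(2 * l * t)) * ‖N (V t)‖ ^ 2 := by
    rw [hk]
    gcongr
    exact ht.2
  simp only [G] at h1
  linarith

end Energy

/-! ### Existence by closing up the classical solutions -/

section Existence

variable {X : Type} [NormedAddCommGroup X] [InnerProductSpace ℂ X]

theorem memLp_two_of_continuous {E : Type*} [NormedAddCommGroup E] (T : ℝ) {φ : ℝ → E}
    (hφ : Continuous φ) : MemLp φ 2 ((volume : Measure ℝ).restrict (Ioo 0 T)) := by
  obtain ⟨C, hC⟩ := (isCompact_Icc (a := 0) (b := T)).exists_bound_of_continuousOn hφ.continuousOn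
  refine MemLp.of_bound hφ.aestronglyMeasurable C ?_
  filter_upwards [ae_restrict_mem measurableSet_Ioo] with t ht
  exact hC t (Ioo_subset_Icc_self ht)

theorem norm_sq_eq_integral {T : ℝ} (hT : 0 < T) {U : L2Time T X} {V : ℝ → X}
    (h : U =ᵐ[(volume : Measure ℝ).restrict (Ioo 0 T)] V) :
    ‖U‖ ^ 2 = ∫ t in (0 : ℝ)..T, ‖V t‖ ^ 2 := by
  rw [intervalIntegral.integral_of_le hT.le, integral_Ioc_eq_integral_Ioo]
  have h1 := L2.integral_inner_eq_sq_eLpNorm (𝕜 := ℂ) U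
  have h2 := L2.inner_def (𝕜 := ℂ) U U
  rw [inner_self_eq_norm_sq_to_K] at h2
  have h3 : ((‖U‖ ^ 2 : ℝ) : ℂ) = ((∫ t in Ioo 0 T, ‖V t‖ ^ 2 : ℝ) : ℂ) := by
    rw [← integral_complex_ofReal]
    push_cast
    refine h2.trans (integral_congr_ae ?_)
    filter_upwards [h] with t ht
    rw [ht, inner_self_eq_norm_sq_to_K]
    rfl
  exact_mod_cast h3

/-- This is the pairing of `L²` with the fixed function `φ`; it makes the weak formulation a closed
condition. -/
theorem continuous_integral_smul [CompleteSpace X] (T : ℝ) {φ : ℝ → ℝ} (hφ : Continuous φ) :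
    Continuous fun U : L2Time T X ↦ ∫ t in Ioo 0 T, φ t • U t := by
  have h := memLp_two_of_continuous T hφ
  have : (fun U : L2Time T X ↦ ∫ t in Ioo 0 T, φ t • U t) = fun U ↦
      (ContinuousLinearMap.lsmul ℝ ℝ : ℝ →L[ℝ] X →L[ℝ] X).lpPairing
        ((volume : Measure ℝ).restrict (Ioo 0 T)) 2 2 h.toLp U := by
    ext U
    rw [ContinuousLinearMap.lpPairing_eq_integral]
    refine integral_congr_ae ?_
    filter_upwards [h.coeFn_toLp] with t ht
    simp [ht]
  rw [this]
  exact ContinuousLinearMap.continuous _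

/-- Quadruples of a right-hand side and a solution, with their initial value and their continuous
representative. -/
abbrev SolutionData (T : ℝ) (X : Type) [NormedAddCommGroup X] : Type :=
  (X × L2Time T X) × (L2Time T X × (ℝ →ᵇ X))

/-- Classical solutions `(g, f, V, N V)` of `N² V' + B V = f`, `N V(0) = g`. -/
def classicalSolutions {T : ℝ} (hT : 0 < T) (N B : X →L[ℂ] X) :
    Submodule ℂ (SolutionData T X) where
  carrier := {q | ∃ V D f : ℝ → X, (∀ t, HasDerivAt V (D t) t) ∧ Continuous f ∧
    (∀ t, N (N (D t)) = f t - B (V t)) ∧ q.1.1 = N (V 0) ∧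
    q.1.2 =ᵐ[(volume : Measure ℝ).restrict (Ioo 0 T)] f ∧
    q.2.1 =ᵐ[(volume : Measure ℝ).restrict (Ioo 0 T)] V ∧
    ∀ t, q.2.2 t = N (V (projIcc 0 T hT.le t))}
  add_mem' := by
    rintro p q ⟨V, D, f, h1, h2, h3, h4, h5, h6, h7⟩ ⟨V', D', f', h1', h2', h3', h4', h5', h6', h7'⟩
    refine ⟨V + V', D + D', f + f', fun t ↦ (h1 t).add (h1' t), h2.add h2', fun t ↦ ?_, ?_,
      (Lp.coeFn_add _ _).trans (h5.add h5'), (Lp.coeFn_add _ _).trans (h6.add h6'), fun t ↦ ?_⟩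
    · simp only [Pi.add_apply, map_add, h3, h3']
      abel
    · simp [h4, h4']
    · simp [h7, h7']
  zero_mem' := by
    refine ⟨0, 0, 0, fun t ↦ hasDerivAt_const t 0, continuous_const, fun t ↦ by simp, by simp,
      Lp.coeFn_zero _ _ _, Lp.coeFn_zero _ _ _, fun t ↦ by simp⟩
  smul_mem' := by
    rintro a p ⟨V, D, f, h1, h2, h3, h4, h5, h6, h7⟩
    refine ⟨a • V, a • D, a • f, fun t ↦ (h1 t).const_smul a, h2.const_smul a, fun t ↦ ?_, ?_,
      (Lp.coeFn_smul _ _).trans (h5.const_smul a), (Lp.coeFn_smul _ _).trans (h6.const_smul a),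
      fun t ↦ ?_⟩
    · simp only [Pi.smul_apply, map_smul, h3, smul_sub]
    · simp [h4]
    · simp [h7]

/-- `energy_estimate` at `t = T` controls `V` in `L²`, and at arbitrary `t` it controls `N V`
uniformly. -/
theorem classicalSolutions_bound {T : ℝ} (hT : 0 < T) {N B : X →L[ℂ] X}
    (hN : ∀ x y, ⟪N x, y⟫_ℂ = ⟪x, N y⟫_ℂ) {c l : ℝ} (hc : 0 < c) (hl : 0 ≤ l)
    (hB : ∀ x, c * ‖x‖ ^ 2 - l * ‖N x‖ ^ 2 ≤ (⟪x, B x⟫_ℂ).re) :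
    ∃ K : ℝ, ∀ q ∈ classicalSolutions hT N B, ‖q.2‖ ≤ K * ‖q.1‖ := by
  set k := Real.exp (-(2 * l * T)) with hk
  have hk0 : 0 < k := Real.exp_pos _
  -- `1 + c⁻¹` collects the initial value and the right-hand side; `k⁻¹` and `(c * k)⁻¹` come from
  -- dividing by the coefficients of the two terms on the left of the estimate.
  refine ⟨Real.sqrt ((1 + c⁻¹) * (k⁻¹ + (c * k)⁻¹)), ?_⟩
  rintro q ⟨V, D, f, h1, h2, h3, h4, h5, h6, h7⟩
  have hpos : 0 ≤ (1 + c⁻¹) * (k⁻¹ + (c * k)⁻¹) := by positivity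
  have hF := norm_sq_eq_integral hT h5
  have hU := norm_sq_eq_integral hT h6
  have hf1 : ‖q.1.2‖ ^ 2 ≤ ‖q.1‖ ^ 2 := by gcongr; exact norm_snd_le q.1
  have hg1 : ‖q.1.1‖ ^ 2 ≤ ‖q.1‖ ^ 2 := by gcongr; exact norm_fst_le q.1
  have hnn : ∀ (W : ℝ → X), ∀ t ∈ Icc 0 T, 0 ≤ ∫ s in (0 : ℝ)..t, ‖W s‖ ^ 2 := fun W t ht ↦
    intervalIntegral.integral_nonneg ht.1 fun _ _ ↦ by positivity
  have hmono : ∀ t ∈ Icc 0 T, ∫ s in (0 : ℝ)..t, ‖f s‖ ^ 2 ≤ ∫ s in (0 : ℝ)..T, ‖f s‖ ^ 2 :=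
    fun t ht ↦ intervalIntegral.integral_mono_interval le_rfl ht.1 ht.2
      (.of_forall fun _ ↦ by positivity) ((h2.norm.pow 2).intervalIntegrable _ _)
  have key : ∀ t ∈ Icc 0 T, k * ‖N (V t)‖ ^ 2 + c * k * ∫ s in (0 : ℝ)..t, ‖V s‖ ^ 2 ≤
      (1 + c⁻¹) * ‖q.1‖ ^ 2 := fun t ht ↦ by
    refine (energy_estimate hN hc hl hB h1 h2 h3 ht).trans ?_
    rw [← h4, add_mul, one_mul]
    gcongr
    exact (hmono t ht).trans (hF ▸ hf1)
  have hsq : ∀ {a : ℝ}, 0 ≤ a → a ^ 2 ≤ (1 + c⁻¹) * (k⁻¹ + (c * k)⁻¹) * ‖q.1‖ ^ 2 →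
      a ≤ Real.sqrt ((1 + c⁻¹) * (k⁻¹ + (c * k)⁻¹)) * ‖q.1‖ := fun {a} ha h ↦ by
    refine (sq_le_sq₀ ha (by positivity)).1 ?_
    rwa [mul_pow, Real.sq_sqrt hpos]
  have hck : 0 < c * k := by positivity
  have hQ : 0 ≤ (1 + c⁻¹) * ‖q.1‖ ^ 2 := by positivity
  refine norm_prod_le_iff.2 ⟨hsq (norm_nonneg _) ?_,
    (BoundedContinuousFunction.norm_le (by positivity)).2 fun t ↦ hsq (norm_nonneg _) ?_⟩
  · have h8 := key T (right_mem_Icc.2 hT.le)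
    have h9 : c * k * ‖q.2.1‖ ^ 2 ≤ (1 + c⁻¹) * ‖q.1‖ ^ 2 := by
      rw [hU]
      have : 0 ≤ k * ‖N (V T)‖ ^ 2 := by positivity
      linarith
    rw [mul_comm, ← le_div_iff₀ hck, div_eq_mul_inv] at h9
    refine h9.trans ?_
    have : 0 ≤ (1 + c⁻¹) * ‖q.1‖ ^ 2 * k⁻¹ := by positivity
    linarith
  · have h8 := key _ (projIcc 0 T hT.le t).2
    rw [h7]
    have h9 : k * ‖N (V (projIcc 0 T hT.le t))‖ ^ 2 ≤ (1 + c⁻¹) * ‖q.1‖ ^ 2 := by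
      have := mul_nonneg hck.le (hnn V _ (projIcc 0 T hT.le t).2)
      linarith
    rw [mul_comm, ← le_div_iff₀ hk0, div_eq_mul_inv] at h9
    refine h9.trans ?_
    have : 0 ≤ (1 + c⁻¹) * ‖q.1‖ ^ 2 * (c * k)⁻¹ := by positivity
    linarith

variable [CompleteSpace X]

theorem integral_smul_sub_apply {T : ℝ} (B : X →L[ℂ] X) {η : ℝ → ℝ} (hη : Continuous η)
    (F U : L2Time T X) : ∫ t in Ioo 0 T, η t • (F t - B (U t)) =
      (∫ t in Ioo 0 T, η t • F t) - B (∫ t in Ioo 0 T, η t • U t) := by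
  have h1 := integrable_smul_of_continuous hη (Lp.memLp F)
  have h2 := integrable_smul_of_continuous hη (Lp.memLp U)
  rw [← B.integral_comp_comm h2, ← integral_sub h1 (B.integrable_comp h2)]
  refine integral_congr_ae (.of_forall fun t ↦ ?_)
  simp only [ContinuousLinearMap.map_smul_of_tower, smul_sub]

/-- Limits of classical solutions are weak solutions. -/
theorem isDegenerateSolution_of_mem_closure {T : ℝ} (hT : 0 < T) {N B : X →L[ℂ] X}
    {q : SolutionData T X}
    (hq : q ∈ closure (classicalSolutions hT N B : Set (SolutionData T X))) :
    IsDegenerateSolution N B q.1.2 q.1.1 q.2.1 := by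
  let μ : Measure ℝ := (volume : Measure ℝ).restrict (Ioo 0 T)
  -- Initial value, agreement of `N U` with its continuous representative, and the weak equation
  -- against a fixed `η` are closed conditions; each is then checked on classical solutions.
  have c1 : IsClosed {q : SolutionData T X | q.2.2 0 = q.1.1} :=
    isClosed_eq ((continuous_eval_const (0 : ℝ)).comp
      (continuous_snd.comp continuous_snd)) (continuous_fst.comp continuous_fst)
  have c2 : IsClosed {q : SolutionData T X |
      N.compLpL 2 μ q.2.1 = BoundedContinuousFunction.toLp 2 μ ℂ q.2.2} :=
    isClosed_eq ((N.compLpL 2 μ).continuous.comp (continuous_fst.comp continuous_snd))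
      ((BoundedContinuousFunction.toLp 2 μ ℂ).continuous.comp (continuous_snd.comp continuous_snd))
  have c3 : ∀ η : ℝ → ℝ, ContDiff ℝ ∞ η →
      IsClosed {q : SolutionData T X |
        N (N (∫ t in Ioo 0 T, deriv η t • q.2.1 t)) =
          -∫ t in Ioo 0 T, η t • (q.1.2 t - B (q.2.1 t))} := fun η hη ↦ by
    simp only [integral_smul_sub_apply B hη.continuous]
    refine isClosed_eq (N.continuous.comp (N.continuous.comp ((continuous_integral_smul T
      (hη.continuous_deriv (by simp))).comp (continuous_fst.comp continuous_snd)))) ?_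
    exact (((continuous_integral_smul T hη.continuous).comp
      (continuous_snd.comp continuous_fst)).sub (B.continuous.comp
      ((continuous_integral_smul T hη.continuous).comp (continuous_fst.comp continuous_snd)))).neg
  have hsub1 : (classicalSolutions hT N B : Set (SolutionData T X)) ⊆ {q | q.2.2 0 = q.1.1} := by
    rintro q ⟨V, D, f, h1, h2, h3, h4, h5, h6, h7⟩
    rw [mem_ofPred_eq, h7, h4, projIcc_of_le_left _ le_rfl]
  have hsub2 : (classicalSolutions hT N B : Set (SolutionData T X)) ⊆
      {q | N.compLpL 2 μ q.2.1 = BoundedContinuousFunction.toLp 2 μ ℂ q.2.2} := by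
    rintro q ⟨V, D, f, h1, h2, h3, h4, h5, h6, h7⟩
    refine Lp.ext ?_
    filter_upwards [N.coeFn_compLpL q.2.1, BoundedContinuousFunction.coeFn_toLp 2 μ ℂ q.2.2, h6,
      ae_restrict_mem measurableSet_Ioo] with t t1 t2 t3 t4
    rw [t1, t2, t3, h7, projIcc_of_mem hT.le (Ioo_subset_Icc_self t4)]
  have hsub3 : ∀ η : ℝ → ℝ, ContDiff ℝ ∞ η → tsupport η ⊆ Ioo 0 T →
      (classicalSolutions hT N B : Set (SolutionData T X)) ⊆
        {q | N (N (∫ t in Ioo 0 T, deriv η t • q.2.1 t)) =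
          -∫ t in Ioo 0 T, η t • (q.1.2 t - B (q.2.1 t))} := by
    rintro η hη hs q ⟨V, D, f, h1, h2, h3, h4, h5, h6, h7⟩
    have hVc : Continuous V := continuous_iff_continuousAt.2 fun t ↦ (h1 t).continuousAt
    have e1 : ∫ t in Ioo 0 T, deriv η t • q.2.1 t = ∫ t in Ioo 0 T, deriv η t • V t :=
      integral_congr_ae (by filter_upwards [h6] with t ht; rw [ht])
    have e2 : ∫ t in Ioo 0 T, η t • (q.1.2 t - B (q.2.1 t)) =
        ∫ t in Ioo 0 T, η t • N (N (D t)) :=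
      integral_congr_ae (by filter_upwards [h5, h6] with t t5 t6; rw [t5, t6, h3])
    have e3 := integral_deriv_smul_eq_neg hT hη hs (V := fun t ↦ N (N (V t)))
      (D := fun t ↦ N (N (D t)))
      (fun t ↦ ((N ∘L N).restrictScalars ℝ).hasFDerivAt.comp_hasDerivAt t (h1 t))
      (by simp only [h3]; exact h2.sub (B.continuous.comp hVc))
    have e4 := (N ∘L N).integral_comp_comm (integrable_smul_of_continuous
      (hη.continuous_deriv (by simp)) (memLp_two_of_continuous T hVc))
    simp only [ContinuousLinearMap.comp_apply, ContinuousLinearMap.map_smul_of_tower] at e4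
    rw [mem_ofPred_eq, e1, e2, ← e3, e4]
  have hq2 := closure_minimal hsub2 c2 hq
  refine ⟨⟨q.2.2, q.2.2.continuous.continuousOn, ?_, closure_minimal hsub1 c1 hq⟩,
    fun η a _ b ↦ closure_minimal (hsub3 η a b) (c3 η a) hq⟩
  filter_upwards [N.coeFn_compLpL q.2.1, BoundedContinuousFunction.coeFn_toLp 2 μ ℂ q.2.2]
    with t t1 t2
  rw [← t1, ← t2, hq2]

/-- The problem with truncated continuous data has a classical solution. -/
theorem IsCutoff.exists_classicalSolution {T : ℝ} (hT : 0 < T) {N B : X →L[ℂ] X}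
    {P R : ℕ → X →L[ℂ] X} (h : IsCutoff N B P R) (n : ℕ) (g : X) (f : ℝ →ᵇ X) :
    (P n g, (P n).compLpL 2 ((volume : Measure ℝ).restrict (Ioo 0 T))
      (BoundedContinuousFunction.toLp 2 _ ℂ f)) ∈
      Prod.fst '' (classicalSolutions hT N B : Set (SolutionData T X)) := by
  let L : X →L[ℂ] X := R n ∘L B ∘L R n
  obtain ⟨v, hv0, hv⟩ := exists_hasDerivAt_linear (L.restrictScalars ℝ)
    (h := fun t ↦ R n (f t)) ((R n).continuous.comp f.continuous) (P n g)
  have hvc : Continuous v := continuous_iff_continuousAt.2 fun t ↦ (hv t).continuousAt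
  have hVc : Continuous fun t ↦ R n (v t) := (R n).continuous.comp hvc
  -- Precomposing with `projIcc` freezes the values outside `[0, T]`, which makes the function
  -- bounded on the whole line.
  have hNVc : Continuous fun t ↦ N (R n (v (projIcc 0 T hT.le t))) :=
    N.continuous.comp (hVc.comp (continuous_subtype_val.comp continuous_projIcc))
  obtain ⟨C, hC⟩ := (isCompact_Icc (a := 0) (b := T)).exists_bound_of_continuousOn
    (N.continuous.comp hVc).continuousOn
  have hV := memLp_two_of_continuous T hVc
  refine ⟨((P n g, _), (hV.toLp, BoundedContinuousFunction.ofNormedAddCommGroup _ hNVc C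
    fun t ↦ hC _ (projIcc 0 T hT.le t).2)), ⟨fun t ↦ R n (v t),
    fun t ↦ R n (-(L (v t)) + R n (f t)), fun t ↦ P n (f t),
    fun t ↦ ((R n).restrictScalars ℝ).hasFDerivAt.comp_hasDerivAt t (hv t),
    (P n).continuous.comp f.continuous, fun t ↦ ?_, ?_, ?_, hV.coeFn_toLp, fun t ↦ rfl⟩, rfl⟩
  · simp only [L, ContinuousLinearMap.comp_apply, map_add, map_neg, h.apply_right, h.proj_left]
    rw [h.comm, h.proj_left]
    abel
  · simp only [hv0, h.apply_right]
    -- Idempotence of `P n`: it equals `R n` after `N`, and it fixes the range of `R n`.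
    rw [← h.apply_left n g, h.proj_left]
  · filter_upwards [(P n).coeFn_compLpL (p := 2)
      (BoundedContinuousFunction.toLp 2 ((volume : Measure ℝ).restrict (Ioo 0 T)) ℂ f),
      BoundedContinuousFunction.coeFn_toLp 2 ((volume : Measure ℝ).restrict (Ioo 0 T)) ℂ f]
      with t t1 t2
    rw [t1, t2]

/-- For fixed `n`, density of bounded continuous functions in `L²` reaches all data truncated by `P
n`; dominated convergence then removes the truncation. -/
theorem IsCutoff.mem_closure {T : ℝ} (hT : 0 < T) {N B : X →L[ℂ] X}
    {P R : ℕ → X →L[ℂ] X} (h : IsCutoff N B P R) (g : X) (F : L2Time T X) :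
    (g, F) ∈ closure (Prod.fst '' (classicalSolutions hT N B : Set (SolutionData T X))) := by
  let μ : Measure ℝ := (volume : Measure ℝ).restrict (Ioo 0 T)
  have h1 : ∀ n, (P n g, (P n).compLpL 2 μ F) ∈
      closure (Prod.fst '' (classicalSolutions hT N B : Set (SolutionData T X))) := fun n ↦ by
    refine (BoundedContinuousFunction.toLp_denseRange X μ ℂ
      (ENNReal.ofNat_ne_top : (2 : ℝ≥0∞) ≠ _)).induction_on
      (p := fun F ↦ (P n g, (P n).compLpL 2 μ F) ∈
        closure (Prod.fst '' (classicalSolutions hT N B : Set (SolutionData T X)))) F ?_ fun f ↦ ?_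
    · exact isClosed_closure.preimage
        (continuous_const.prodMk ((P n).compLpL 2 μ).continuous)
    · exact subset_closure (h.exists_classicalSolution hT n g f)
  refine isClosed_closure.mem_of_tendsto (Tendsto.prodMk_nhds (h.tendsto g) ?_) (.of_forall h1)
  refine tendsto_Lp_two_of_dominated (fun n ↦ ?_) ?_
  · filter_upwards [(P n).coeFn_compLpL F] with t ht
    rw [ht]
    exact h.norm_le n _
  · filter_upwards [ae_all_iff.2 fun n ↦ (P n).coeFn_compLpL F] with t ht
    exact (h.tendsto _).congr fun n ↦ (ht n).symm

/-- Existence of solutions of the degenerate problem under a Gårding inequality. -/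
theorem IsCutoff.exists_solution {T : ℝ} (hT : 0 < T) {N B : X →L[ℂ] X}
    {P R : ℕ → X →L[ℂ] X} (h : IsCutoff N B P R)
    (hN : ∀ x y, ⟪N x, y⟫_ℂ = ⟪x, N y⟫_ℂ) {c l : ℝ} (hc : 0 < c) (hl : 0 ≤ l)
    (hB : ∀ x, c * ‖x‖ ^ 2 - l * ‖N x‖ ^ 2 ≤ (⟪x, B x⟫_ℂ).re) (g : X) (F : L2Time T X) :
    ∃ U : L2Time T X, IsDegenerateSolution N B F g U := by
  obtain ⟨K, hK⟩ := classicalSolutions_bound hT hN hc hl hB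
  obtain ⟨y, hy⟩ := exists_mem_closure_of_bound _ hK (h.mem_closure hT g F)
  exact ⟨y.1, isDegenerateSolution_of_mem_closure hT hy⟩

end Existence

/-! ### The Fourier transform on `L²` -/

section FourierL2

variable {d : ℕ}

theorem quasiMeasurePreserving_smul {c : ℝ} (hc : c ≠ 0) :
    Measure.QuasiMeasurePreserving (fun x : Rd d ↦ c • x) volume volume := by
  refine ⟨measurable_const_smul c, ?_⟩
  rw [Measure.map_addHaar_smul _ hc]
  exact Measure.smul_absolutelyContinuous

theorem eLpNorm_comp_smul {c : ℝ} (hc : c ≠ 0) {f : Rd d → ℂ}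
    (hf : AEStronglyMeasurable f volume) :
    eLpNorm (fun x ↦ f (c • x)) 2 volume =
      ENNReal.ofReal |(c ^ Module.finrank ℝ (Rd d))⁻¹| ^ (1 / 2 : ℝ) * eLpNorm f 2 volume := by
  have h1 := eLpNorm_map_measure (p := 2) (μ := (volume : Measure (Rd d)))
    (f := fun x : Rd d ↦ c • x) (g := f)
    (by rw [Measure.map_addHaar_smul _ hc]; exact hf.smul_measure _)
    (measurable_const_smul c).aemeasurable
  rw [Measure.map_addHaar_smul _ hc, eLpNorm_smul_measure_of_ne_top ENNReal.ofNat_ne_top] at h1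
  simpa [Function.comp_def] using h1.symm

theorem memLp_comp_smul {c : ℝ} (hc : c ≠ 0) {f : Rd d → ℂ} (hf : MemLp f 2 volume) :
    MemLp (fun x ↦ f (c • x)) 2 volume := by
  refine ⟨hf.1.comp_quasiMeasurePreserving (quasiMeasurePreserving_smul hc), ?_⟩
  rw [eLpNorm_comp_smul hc hf.1]
  exact ENNReal.mul_lt_top (ENNReal.rpow_lt_top_of_nonneg (by norm_num) ENNReal.ofReal_ne_top) hf.2

/-- The dilation `f ↦ f(c ·)` on `L²`. -/
def dilationL2 (d : ℕ) {c : ℝ} (hc : c ≠ 0) :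
    Lp ℂ 2 (volume : Measure (Rd d)) →L[ℂ] Lp ℂ 2 (volume : Measure (Rd d)) :=
  LinearMap.mkContinuous
    { toFun := fun f ↦ (memLp_comp_smul hc (Lp.memLp f)).toLp
      map_add' := fun f g ↦ by
        rw [← MemLp.toLp_add]
        exact MemLp.toLp_congr _ _
          ((quasiMeasurePreserving_smul hc).ae_eq_comp (Lp.coeFn_add f g))
      map_smul' := fun a f ↦ by
        rw [RingHom.id_apply, ← MemLp.toLp_const_smul]
        exact MemLp.toLp_congr _ _
          ((quasiMeasurePreserving_smul hc).ae_eq_comp (Lp.coeFn_smul a f)) }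
    (ENNReal.ofReal |(c ^ Module.finrank ℝ (Rd d))⁻¹| ^ (1 / 2 : ℝ)).toReal fun f ↦ by
      simp only [LinearMap.coe_mk, AddHom.coe_mk]
      rw [Lp.norm_toLp, eLpNorm_comp_smul hc (Lp.aestronglyMeasurable f), ENNReal.toReal_mul,
        Lp.norm_def]

theorem coeFn_dilationL2 {c : ℝ} (hc : c ≠ 0) (f : Lp ℂ 2 (volume : Measure (Rd d))) :
    dilationL2 d hc f =ᵐ[volume] fun x ↦ f (c • x) :=
  (memLp_comp_smul hc (Lp.memLp f)).coeFn_toLp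

theorem dilationL2_dilationL2 {c c' : ℝ} (hc : c ≠ 0) (hc' : c' ≠ 0) (h : c' * c = 1)
    (f : Lp ℂ 2 (volume : Measure (Rd d))) : dilationL2 d hc (dilationL2 d hc' f) = f := by
  refine Lp.ext ?_
  filter_upwards [coeFn_dilationL2 hc (dilationL2 d hc' f),
    (quasiMeasurePreserving_smul hc).ae_eq_comp (coeFn_dilationL2 hc' f)] with x h1 h2
  rw [h1]
  simp only [Function.comp_apply] at h2
  rw [h2, smul_smul, h, one_smul]

theorem two_pi_ne_zero : (2 * Real.pi : ℝ) ≠ 0 := by positivity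

/-- The Fourier transform on `L²`. -/
def fourierL2 (d : ℕ) :
    Lp ℂ 2 (volume : Measure (Rd d)) ≃L[ℂ] Lp ℂ 2 (volume : Measure (Rd d)) :=
  ((ContinuousLinearEquiv.equivOfInverse (dilationL2 d two_pi_ne_zero)
      (dilationL2 d (inv_ne_zero two_pi_ne_zero))
      (dilationL2_dilationL2 _ _ (mul_inv_cancel₀ two_pi_ne_zero))
      (dilationL2_dilationL2 _ _ (inv_mul_cancel₀ two_pi_ne_zero))).trans
    (Lp.fourierTransformₗᵢ (Rd d) ℂ).symm.toContinuousLinearEquiv).trans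
    (ContinuousLinearEquiv.smulLeft (Units.mk0 (((2 * Real.pi) ^ d : ℝ) : ℂ)
      (by exact_mod_cast pow_ne_zero d two_pi_ne_zero)))

theorem fourierL2_apply (v : Lp ℂ 2 (volume : Measure (Rd d))) :
    fourierL2 d v = (((2 * Real.pi) ^ d : ℝ) : ℂ) • 𝓕⁻ (dilationL2 d two_pi_ne_zero v) := rfl

/-- In the normalization of `𝓕⁻`, `û(ξ)` is `𝓕⁻ u` at `ξ / (2π)`. Dilating `u` by `2π` beforehand
does the same up to `(2π)^(-d)`, which the factor `(2π)^d` in `fourierL2` cancels. Testing against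
`φ` reduces this to a change of variables. -/
theorem hasFourierTransform_fourierL2 (v : Lp ℂ 2 (volume : Measure (Rd d))) :
    HasFourierTransform (Lp.toTemperedDistribution v) (fourierL2 d v) := by
  refine ⟨(Lp.memLp _).locallyIntegrable one_le_two, fun φ ↦ ⟨?_, ?_⟩⟩
  · exact (φ.memLp 2 volume).integrable_mul (Lp.memLp _)
  · have h1 : ∫ ξ, φ ξ * fourierL2 d v ξ = Lp.toTemperedDistribution (fourierL2 d v) φ := by
      rw [Lp.toTemperedDistribution_apply]; rfl
    have h2 : Lp.toTemperedDistribution (fourierL2 d v) φ = (((2 * Real.pi) ^ d : ℝ) : ℂ) *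
        Lp.toTemperedDistribution (dilationL2 d two_pi_ne_zero v) (𝓕⁻ φ) := by
      rw [fourierL2_apply, ← TemperedDistribution.fourierInv_apply,
        Lp.fourierInv_toTemperedDistribution_eq, Lp.toTemperedDistribution_apply,
        Lp.toTemperedDistribution_apply, ← integral_const_mul]
      refine integral_congr_ae ?_
      filter_upwards [Lp.coeFn_smul (((2 * Real.pi) ^ d : ℝ) : ℂ)
        (𝓕⁻ (dilationL2 d two_pi_ne_zero v))] with x hx
      rw [hx, Pi.smul_apply, smul_eq_mul, smul_eq_mul, smul_eq_mul]
      ring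
    have h3 := Measure.integral_comp_smul (volume : Measure (Rd d))
      (fun x ↦ (𝓕⁻ φ : 𝓢(Rd d, ℂ)) ((2 * Real.pi)⁻¹ • x) * v x) (2 * Real.pi)
    rw [h1, h2, Lp.toTemperedDistribution_apply, Lp.toTemperedDistribution_apply]
    have h4 : ∫ x, (𝓕⁻ φ : 𝓢(Rd d, ℂ)) x • dilationL2 d two_pi_ne_zero v x =
        ∫ x : Rd d, (𝓕⁻ φ : 𝓢(Rd d, ℂ)) ((2 * Real.pi)⁻¹ • (2 * Real.pi) • x) *
          v ((2 * Real.pi) • x) := by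
      refine integral_congr_ae ?_
      filter_upwards [coeFn_dilationL2 two_pi_ne_zero v] with x hx
      rw [hx, inv_smul_smul₀ two_pi_ne_zero, smul_eq_mul]
    have h5 : ∫ x, fourierS d φ x • v x =
        ∫ x, (𝓕⁻ φ : 𝓢(Rd d, ℂ)) ((2 * Real.pi)⁻¹ • x) * v x := by
      simp only [fourierS_eq, fourierInv_coe, smul_eq_mul]
    rw [h4, h3, h5, finrank_euclideanSpace, Fintype.card_fin, abs_of_pos (by positivity),
      Complex.real_smul, ← mul_assoc, ← Complex.ofReal_mul,
      mul_inv_cancel₀ (pow_ne_zero d two_pi_ne_zero), Complex.ofReal_one, one_mul]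

theorem HasFourierTransform.eq_of_ae_eq {u₁ u₂ : 𝓢'(Rd d, ℂ)} {h₁ h₂ : Rd d → ℂ}
    (H₁ : HasFourierTransform u₁ h₁) (H₂ : HasFourierTransform u₂ h₂) (h : h₁ =ᵐ[volume] h₂) :
    u₁ = u₂ := by
  ext ψ
  obtain ⟨φ, rfl⟩ := (fourierS d).surjective ψ
  rw [((H₁.congr h).2 φ).2, (H₂.2 φ).2]

/-- Through this, every identity between distributions in the problem becomes an almost everywhere
identity of functions of `ξ`. -/
theorem HasFourierTransform.eq_iff {u₁ u₂ : 𝓢'(Rd d, ℂ)} {h₁ h₂ : Rd d → ℂ}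
    (H₁ : HasFourierTransform u₁ h₁) (H₂ : HasFourierTransform u₂ h₂) :
    u₁ = u₂ ↔ h₁ =ᵐ[volume] h₂ :=
  ⟨fun e ↦ H₁.unique (e ▸ H₂), H₁.eq_of_ae_eq H₂⟩

end FourierL2

/-! ### Multiplication operators -/

/-- The Hilbert space `L²(ℝᵈ)` with only its complex structure, so that its real structure is the
one restricted from the complex one. -/
def L2Space (d : ℕ) : Type := Lp ℂ 2 (volume : Measure (Rd d))

namespace L2Space

variable {d : ℕ}

instance : NormedAddCommGroup (L2Space d) :=
  inferInstanceAs (NormedAddCommGroup (Lp ℂ 2 (volume : Measure (Rd d))))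

instance : InnerProductSpace ℂ (L2Space d) :=
  inferInstanceAs (InnerProductSpace ℂ (Lp ℂ 2 (volume : Measure (Rd d))))

instance : CompleteSpace (L2Space d) :=
  inferInstanceAs (CompleteSpace (Lp ℂ 2 (volume : Measure (Rd d))))

/-- The function represented by an element of `L²`. -/
def fn (f : L2Space d) : Rd d → ℂ := (show Lp ℂ 2 (volume : Measure (Rd d)) from f)

theorem ext {f g : L2Space d} (h : fn f =ᵐ[volume] fn g) : f = g := Lp.ext h

theorem fn_congr {f g : L2Space d} (h : f = g) : fn f =ᵐ[volume] fn g := by rw [h]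

theorem fn_sub (f g : L2Space d) : fn (f - g) =ᵐ[volume] fn f - fn g := Lp.coeFn_sub _ _

theorem fn_add (f g : L2Space d) : fn (f + g) =ᵐ[volume] fn f + fn g := Lp.coeFn_add _ _

theorem fn_smul (c : ℂ) (f : L2Space d) : fn (c • f) =ᵐ[volume] c • fn f := Lp.coeFn_smul _ _

theorem inner_eq (f g : L2Space d) : ⟪f, g⟫_ℂ = ∫ ξ, ⟪fn f ξ, fn g ξ⟫_ℂ := L2.inner_def _ _

/-- Multiplication by an essentially bounded function. -/
def mulOp {a : Rd d → ℂ} (ha : MemLp a ⊤ volume) : L2Space d →L[ℂ] L2Space d :=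
  (ContinuousLinearMap.lsmul ℂ ℂ : ℂ →L[ℂ] ℂ →L[ℂ] ℂ).holderL (volume : Measure (Rd d)) ⊤ 2 2
    ha.toLp

theorem fn_mulOp {a : Rd d → ℂ} (ha : MemLp a ⊤ volume) (f : L2Space d) :
    fn (mulOp ha f) =ᵐ[volume] fun ξ ↦ a ξ * fn f ξ := by
  have h := ContinuousLinearMap.coeFn_holder (r := 2)
    (ContinuousLinearMap.lsmul ℂ ℂ : ℂ →L[ℂ] ℂ →L[ℂ] ℂ) ha.toLp
    (show Lp ℂ 2 (volume : Measure (Rd d)) from f)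
  filter_upwards [h, ha.coeFn_toLp] with ξ h1 h2
  rw [h2] at h1
  exact h1

theorem mulOp_mulOp {a b c : Rd d → ℂ} (ha : MemLp a ⊤ volume) (hb : MemLp b ⊤ volume)
    (hc : MemLp c ⊤ volume) (h : ∀ ξ, a ξ * b ξ = c ξ) (f : L2Space d) :
    mulOp ha (mulOp hb f) = mulOp hc f := by
  refine ext ?_
  filter_upwards [fn_mulOp ha (mulOp hb f), fn_mulOp hb f, fn_mulOp hc f] with ξ h1 h2 h3
  rw [h1, h2, h3, ← h, mul_assoc]

theorem inner_mulOp {a : Rd d → ℂ} (ha : MemLp a ⊤ volume)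
    (hr : ∀ ξ, (starRingEnd ℂ) (a ξ) = a ξ) (f g : L2Space d) :
    ⟪mulOp ha f, g⟫_ℂ = ⟪f, mulOp ha g⟫_ℂ := by
  rw [inner_eq, inner_eq]
  refine integral_congr_ae ?_
  filter_upwards [fn_mulOp ha f, fn_mulOp ha g] with ξ h1 h2
  rw [h1, h2]
  simp only [RCLike.inner_apply, map_mul, hr]
  ring

/-- The real part of the integrand is `Re a(ξ) |f(ξ)|²`; the operator Gårding inequality is deduced
from the pointwise one in this way. -/
theorem re_inner_mulOp_nonneg {a : Rd d → ℂ} (ha : MemLp a ⊤ volume) (hr : ∀ ξ, 0 ≤ (a ξ).re)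
    (f : L2Space d) : 0 ≤ (⟪f, mulOp ha f⟫_ℂ).re := by
  have hi : Integrable (fun ξ ↦ ⟪fn f ξ, fn (mulOp ha f) ξ⟫_ℂ) := L2.integrable_inner _ _
  rw [inner_eq]
  refine le_of_le_of_eq ?_ (integral_re hi)
  refine integral_nonneg_of_ae ?_
  filter_upwards [fn_mulOp ha f] with ξ h1
  rw [h1, RCLike.inner_apply, mul_assoc, Complex.mul_conj]
  simp only [Pi.zero_apply, RCLike.re_to_complex, Complex.re_mul_ofReal]
  exact mul_nonneg (hr ξ) (Complex.normSq_nonneg _)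

theorem norm_mulOp_le {a : Rd d → ℂ} (ha : MemLp a ⊤ volume) (h1 : ∀ ξ, ‖a ξ‖ ≤ 1)
    (f : L2Space d) : ‖mulOp ha f‖ ≤ ‖f‖ := by
  refine Lp.norm_le_norm_of_ae_le ?_
  filter_upwards [fn_mulOp ha f] with ξ h2
  refine (congrArg norm h2).trans_le ?_
  rw [norm_mul]
  exact mul_le_of_le_one_left (norm_nonneg _) (h1 ξ)

theorem tendsto_mulOp {a : ℕ → Rd d → ℂ} (ha : ∀ n, MemLp (a n) ⊤ volume)
    (h1 : ∀ n ξ, ‖a n ξ‖ ≤ 1) (hlim : ∀ ξ, Tendsto (fun n ↦ a n ξ) atTop (𝓝 1)) (f : L2Space d) :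
    Tendsto (fun n ↦ mulOp (ha n) f) atTop (𝓝 f) := by
  refine tendsto_Lp_two_of_dominated (E := ℂ) (fun n ↦ ?_) ?_
  · filter_upwards [fn_mulOp (ha n) f] with ξ h2
    refine (congrArg norm h2).trans_le ?_
    rw [norm_mul]
    exact mul_le_of_le_one_left (norm_nonneg _) (h1 n ξ)
  · filter_upwards [ae_all_iff.2 fun n ↦ fn_mulOp (ha n) f] with ξ h2
    have h3 : Tendsto (fun n ↦ a n ξ * fn f ξ) atTop (𝓝 (1 * fn f ξ)) := (hlim ξ).mul_const _
    rw [one_mul] at h3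
    exact h3.congr fun n ↦ (h2 n).symm

end L2Space

open L2Space

/-! ### The operators of the parabolic problem -/

section Operators

variable {d : ℕ}

theorem memLp_top_weight {s : ℝ} (hs : s ≤ 0) :
    MemLp (fun ξ : Rd d ↦ (weight s ξ : ℂ)) ⊤ volume := by
  refine memLp_top_of_bound (Complex.continuous_ofReal.comp
    (continuous_weight s)).aestronglyMeasurable 1 (.of_forall fun ξ ↦ ?_)
  rw [Complex.norm_real, Real.norm_of_nonneg (weight_pos s ξ).le]
  exact Real.rpow_le_one_of_one_le_of_nonpos (by linarith [norm_nonneg ξ]) hs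

/-- The weight `(1 + |ξ|)ˢ`, cut off outside a ball of radius `n`. -/
def cutWeight (s : ℝ) (n : ℕ) (ξ : Rd d) : ℂ :=
  indicator (Metric.closedBall (0 : Rd d) n) (fun ξ ↦ (weight s ξ : ℂ)) ξ

theorem memLp_top_cutWeight (s : ℝ) (n : ℕ) : MemLp (cutWeight (d := d) s n) ⊤ volume := by
  have hc : Continuous fun ξ : Rd d ↦ (weight s ξ : ℂ) :=
    Complex.continuous_ofReal.comp (continuous_weight s)
  obtain ⟨C, hC⟩ := (isCompact_closedBall (0 : Rd d) n).exists_bound_of_continuousOn hc.continuousOn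
  refine memLp_top_of_bound (hc.aestronglyMeasurable.indicator measurableSet_closedBall) (max C 0)
    (.of_forall fun ξ ↦ ?_)
  by_cases h : ξ ∈ Metric.closedBall (0 : Rd d) n
  · rw [cutWeight, indicator_of_mem h]
    exact (hC ξ h).trans (le_max_left _ _)
  · rw [cutWeight, indicator_of_notMem h, norm_zero]
    exact le_max_right _ _

theorem weight_mul_cutWeight (s r : ℝ) (n : ℕ) (ξ : Rd d) :
    (weight s ξ : ℂ) * cutWeight r n ξ = cutWeight (s + r) n ξ := by
  by_cases h : ξ ∈ Metric.closedBall (0 : Rd d) n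
  · simp only [cutWeight, indicator_of_mem h]
    rw [← Complex.ofReal_mul, weight_mul]
  · simp only [cutWeight, indicator_of_notMem h, mul_zero]

theorem cutWeight_mul_cutWeight (s r : ℝ) (n : ℕ) (ξ : Rd d) :
    cutWeight s n ξ * cutWeight r n ξ = cutWeight (s + r) n ξ := by
  by_cases h : ξ ∈ Metric.closedBall (0 : Rd d) n
  · simp only [cutWeight, indicator_of_mem h]
    rw [← Complex.ofReal_mul, weight_mul]
  · simp only [cutWeight, indicator_of_notMem h, mul_zero]

theorem norm_cutWeight_zero_le (n : ℕ) (ξ : Rd d) : ‖cutWeight 0 n ξ‖ ≤ 1 := by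
  by_cases h : ξ ∈ Metric.closedBall (0 : Rd d) n <;> simp [cutWeight, h, weight]

theorem tendsto_cutWeight_zero (ξ : Rd d) :
    Tendsto (fun n ↦ cutWeight 0 n ξ) atTop (𝓝 1) := by
  refine tendsto_const_nhds.congr' ?_
  obtain ⟨k, hk⟩ := exists_nat_ge ‖ξ‖
  filter_upwards [eventually_ge_atTop k] with n hn
  have : ξ ∈ Metric.closedBall (0 : Rd d) n := by
    rw [mem_closedBall_zero_iff]
    exact hk.trans (by exact_mod_cast hn)
  simp [cutWeight, this, weight]

/-- Multiplication by `(1 + |ξ|)^(-s)`. -/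
def weightOp (d : ℕ) {s : ℝ} (hs : 0 ≤ s) : L2Space d →L[ℂ] L2Space d :=
  mulOp (memLp_top_weight (neg_nonpos.2 hs))

/-- `P n` multiplies by the indicator of the ball of radius `n`, and `R n` by `(1 + |ξ|)ˢ` on that
ball, where it is bounded. All operators are multiplications, so the algebraic identities amount to
adding exponents. -/
theorem isCutoff {s : ℝ} (hs : 0 ≤ s) {b : Rd d → ℂ} (hb : MemLp b ⊤ volume) :
    IsCutoff (weightOp d hs) (mulOp hb) (fun n ↦ mulOp (memLp_top_cutWeight 0 n))
      (fun n ↦ mulOp (memLp_top_cutWeight s n)) where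
  apply_right n x := mulOp_mulOp _ _ _ (fun ξ ↦ by rw [weight_mul_cutWeight, neg_add_cancel]) x
  apply_left n x := mulOp_mulOp _ _ _
    (fun ξ ↦ by rw [mul_comm, weight_mul_cutWeight, neg_add_cancel]) x
  proj_right n x := mulOp_mulOp _ _ _ (fun ξ ↦ by rw [cutWeight_mul_cutWeight, add_zero]) x
  proj_left n x := mulOp_mulOp _ _ _ (fun ξ ↦ by rw [cutWeight_mul_cutWeight, zero_add]) x
  comm n x := by
    have h : MemLp (fun ξ ↦ b ξ * cutWeight 0 n ξ) ⊤ volume := (memLp_top_cutWeight 0 n).mul hb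
    rw [mulOp_mulOp _ _ h (fun ξ ↦ mul_comm _ _), mulOp_mulOp _ _ h fun ξ ↦ rfl]
  norm_le n x := norm_mulOp_le _ (norm_cutWeight_zero_le n) x
  tendsto x := tendsto_mulOp _ norm_cutWeight_zero_le tendsto_cutWeight_zero x

theorem inner_weightOp {s : ℝ} (hs : 0 ≤ s) (x y : L2Space d) :
    ⟪weightOp d hs x, y⟫_ℂ = ⟪x, weightOp d hs y⟫_ℂ :=
  inner_mulOp _ (fun _ ↦ Complex.conj_ofReal _) x y

/-- A lower power is dominated by a small multiple of a higher one, up to a constant. -/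
theorem exists_rpow_le {α β : ℝ} (hβ : β < α) (hβ0 : 0 ≤ β) {C ε : ℝ} (hC : 0 ≤ C) (hε : 0 < ε) :
    ∃ K : ℝ, 0 ≤ K ∧ ∀ t : ℝ, 1 ≤ t → C * t ^ β ≤ ε * t ^ α + K := by
  obtain ⟨t₀, ht₀⟩ := ((tendsto_rpow_atTop (sub_pos.2 hβ)).eventually_ge_atTop
    (C / ε)).exists_forall_of_atTop
  have hm : 0 < max t₀ 1 := lt_of_lt_of_le one_pos (le_max_right _ _)
  -- Beyond `t₀` one has `C ≤ ε t^(α - β)`; up to `max t₀ 1` the left side is at most its value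
  -- there.
  refine ⟨C * max t₀ 1 ^ β, by positivity, fun t ht ↦ ?_⟩
  have ht0 : 0 < t := by linarith
  rcases le_total t (max t₀ 1) with h | h
  · have : C * t ^ β ≤ C * max t₀ 1 ^ β := by gcongr
    have : 0 ≤ ε * t ^ α := by positivity
    linarith
  · have h1 := ht₀ t ((le_max_left _ _).trans h)
    rw [div_le_iff₀ hε] at h1
    have h2 : C * t ^ β ≤ t ^ (α - β) * ε * t ^ β := by gcongr
    have h3 : t ^ (α - β) * ε * t ^ β = ε * t ^ α := by
      rw [mul_right_comm, ← Real.rpow_add ht0, sub_add_cancel, mul_comm]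
    have h4 : 0 ≤ C * max t₀ 1 ^ β := by positivity
    linarith

/-- As `β < α`, the term of order `β` is absorbed by a small part of the leading one; passing from
`|ξ|` to `1 + |ξ|` costs the factor `2 ^ α` and a constant. -/
theorem HasSobolevIndex.exists_garding {A : Rd d → ℂ} {α : ℝ} (h : HasSobolevIndex A α) :
    ∃ c l : ℝ, 0 < c ∧ 0 ≤ l ∧ ∀ ξ, c * weight α ξ - l ≤ (A ξ).re := by
  obtain ⟨hα, -, C₁, C₂, C₃, β, -, hC₂, hC₃, hβ, hβα, -, hA⟩ := h
  have hc : 0 < C₂ / 2 ^ α / 2 := by positivity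
  obtain ⟨K, hK, hKt⟩ := exists_rpow_le hβα hβ hC₃ hc
  -- Half of `C₂ / 2 ^ α` pays for the lower-order term, leaving the error `K`; the other error `C₂`
  -- comes from `(1 + |ξ|)^α ≤ 2^α (|ξ|^α + 1)`.
  refine ⟨C₂ / 2 ^ α / 2, C₂ + K, hc, by positivity, fun ξ ↦ ?_⟩
  have hn := norm_nonneg ξ
  have h1 := hKt (1 + ‖ξ‖) (by linarith)
  have h2 : (1 + ‖ξ‖ ^ 2) ^ (β / 2) ≤ (1 + ‖ξ‖) ^ β := by
    have e : (1 + ‖ξ‖) ^ β = ((1 + ‖ξ‖) ^ 2) ^ (β / 2) := by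
      rw [← Real.rpow_natCast_mul (by positivity)]
      congr 1
      push_cast
      ring
    rw [e]
    gcongr
    nlinarith
  have h3 : (1 + ‖ξ‖) ^ α ≤ 2 ^ α * (‖ξ‖ ^ α + 1) := by
    rcases le_total ‖ξ‖ 1 with h | h
    · calc (1 + ‖ξ‖) ^ α ≤ 2 ^ α := by gcongr; linarith
        _ ≤ _ := le_mul_of_one_le_right (by positivity) (by linarith [Real.rpow_nonneg hn α])
    · calc (1 + ‖ξ‖) ^ α ≤ (2 * ‖ξ‖) ^ α := by gcongr; linarith
        _ = 2 ^ α * ‖ξ‖ ^ α := Real.mul_rpow zero_le_two hn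
        _ ≤ _ := by gcongr; linarith
  have h4 : C₂ / 2 ^ α * (1 + ‖ξ‖) ^ α ≤ C₂ * (‖ξ‖ ^ α + 1) := by
    calc C₂ / 2 ^ α * (1 + ‖ξ‖) ^ α ≤ C₂ / 2 ^ α * (2 ^ α * (‖ξ‖ ^ α + 1)) := by gcongr
      _ = _ := by field_simp
  have h5 : C₃ * (1 + ‖ξ‖ ^ 2) ^ (β / 2) ≤ C₃ * (1 + ‖ξ‖) ^ β := by gcongr
  have h6 := hA ξ
  rw [weight]
  linarith

/-- The Gårding inequality for multiplication by `A(ξ) (1 + |ξ|)^(-α)`. -/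
theorem HasSobolevIndex.exists_garding_mulOp {A : Rd d → ℂ} {α : ℝ} (h : HasSobolevIndex A α)
    (hs : 0 ≤ α / 2) (hb : MemLp (fun ξ ↦ A ξ * (weight (-α) ξ : ℂ)) ⊤ volume) :
    ∃ c l : ℝ, 0 < c ∧ 0 ≤ l ∧ ∀ x : L2Space d,
      c * ‖x‖ ^ 2 - l * ‖weightOp d hs x‖ ^ 2 ≤ (⟪x, mulOp hb x⟫_ℂ).re := by
  obtain ⟨c, l, hc, hl, hA⟩ := h.exists_garding
  refine ⟨c, l, hc, hl, fun x ↦ ?_⟩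
  have hw : MemLp (fun ξ : Rd d ↦ (weight (-α) ξ : ℂ)) ⊤ volume := memLp_top_weight (by linarith)
  -- The pointwise inequality multiplied by `(1 + |ξ|)^(-α)` says that this symbol has nonnegative
  -- real part. Its last term is `l` times the symbol of `N²`, whose quadratic form is `‖N x‖²`.
  have hm : MemLp (fun ξ ↦ A ξ * (weight (-α) ξ : ℂ) - c + l * (weight (-α) ξ : ℂ)) ⊤ volume :=
    (hb.sub (memLp_top_const (c : ℂ))).add (hw.const_mul (l : ℂ))
  have h1 := re_inner_mulOp_nonneg hm (fun ξ ↦ by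
    have h2 := hA ξ
    have h3 := weight_pos (-α) ξ
    have h4 := weight_mul_neg α ξ
    rw [← Complex.ofReal_mul, Complex.add_re, Complex.sub_re, Complex.re_mul_ofReal,
      Complex.ofReal_re, Complex.ofReal_re]
    have h5 : (c * weight α ξ - l) * weight (-α) ξ ≤ (A ξ).re * weight (-α) ξ := by gcongr
    rw [sub_mul, mul_assoc, h4] at h5
    linarith) x
  have e1 : mulOp hm x = mulOp hb x - (c : ℂ) • x + (l : ℂ) • weightOp d hs (weightOp d hs x) := by
    have e2 : weightOp d hs (weightOp d hs x) = mulOp hw x := mulOp_mulOp _ _ _ (fun ξ ↦ by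
      rw [← Complex.ofReal_mul, weight_mul]; congr 2; ring) x
    rw [e2]
    refine L2Space.ext ?_
    filter_upwards [fn_mulOp hm x, fn_add (mulOp hb x - (c : ℂ) • x) ((l : ℂ) • mulOp hw x),
      fn_sub (mulOp hb x) ((c : ℂ) • x), fn_smul (c : ℂ) x, fn_smul (l : ℂ) (mulOp hw x),
      fn_mulOp hb x, fn_mulOp hw x] with ξ t1 t2 t3 t4 t5 t6 t7
    simp only [t1, t2, t3, t4, t5, t6, t7, Pi.add_apply, Pi.sub_apply, Pi.smul_apply, smul_eq_mul]
    ring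
  have e3 : ⟪x, weightOp d hs (weightOp d hs x)⟫_ℂ = ((‖weightOp d hs x‖ ^ 2 : ℝ) : ℂ) := by
    rw [← inner_weightOp, inner_self_eq_norm_sq_to_K]
    norm_cast
  have e4 : ⟪x, x⟫_ℂ = ((‖x‖ ^ 2 : ℝ) : ℂ) := by
    rw [inner_self_eq_norm_sq_to_K]
    norm_cast
  rw [e1, inner_add_right, inner_sub_right, inner_smul_right, inner_smul_right, e3, e4,
    ← Complex.ofReal_mul, ← Complex.ofReal_mul, Complex.add_re, Complex.sub_re,
    Complex.ofReal_re, Complex.ofReal_re] at h1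
  linarith

end Operators

/-! ### Reduction of the parabolic problem to the degenerate problem -/

section Translation

variable {d : ℕ}

/-- The isometry `u ↦ (1 + |ξ|)ˢ û(ξ)` of `Hˢ(ℝᵈ)` onto `L²(ℝᵈ)`. -/
def weightedHat (d : ℕ) (s : ℝ) : Hs d s ≃ₗᵢ[ℂ] L2Space d := Hs.equivL2 d s

theorem fn_weightedHat {s : ℝ} (u : Hs d s) :
    fn (weightedHat d s u) =ᵐ[volume] fun ξ ↦ (weight s ξ : ℂ) * Hs.hat u ξ :=
  Hs.coeFn_equivL2 u

theorem fn_weightOp {s : ℝ} (hs : 0 ≤ s) (x : L2Space d) :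
    fn (weightOp d hs x) =ᵐ[volume] fun ξ ↦ (weight (-s) ξ : ℂ) * fn x ξ :=
  fn_mulOp _ x

theorem ofReal_weight_ne_zero (s : ℝ) (ξ : Rd d) : (weight s ξ : ℂ) ≠ 0 := by
  exact_mod_cast (weight_pos s ξ).ne'

theorem fn_weightOp_weightedHat {s : ℝ} (hs : 0 ≤ s) (u : Hs d s) :
    fn (weightOp d hs (weightedHat d s u)) =ᵐ[volume] Hs.hat u := by
  filter_upwards [fn_weightOp hs (weightedHat d s u), fn_weightedHat u] with ξ h1 h2
  rw [h1, h2, ← mul_assoc, ← Complex.ofReal_mul, weight_neg_mul, Complex.ofReal_one, one_mul]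

/-- The Fourier transform on `L²`, with values in `L2Space`. -/
def fourierSpace (d : ℕ) (v : Lp ℂ 2 (volume : Measure (Rd d))) : L2Space d := fourierL2 d v

theorem continuous_fourierSpace : Continuous (fourierSpace d) := (fourierL2 d).continuous

theorem toDist_eq_toTemperedDistribution_iff {s : ℝ} (hs : 0 ≤ s) (u : Hs d s)
    (v : Lp ℂ 2 (volume : Measure (Rd d))) :
    Hs.toDist u = Lp.toTemperedDistribution v ↔
      weightOp d hs (weightedHat d s u) = fourierSpace d v := by
  rw [(Hs.hasFourierTransform_hat u).eq_iff (hasFourierTransform_fourierL2 v)]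
  have h1 := fn_weightOp_weightedHat hs u
  exact ⟨fun h ↦ L2Space.ext (h1.trans h), fun h ↦ h1.symm.trans (fn_congr h)⟩

/-- Since `N` strips the weight from `U`, a second `N` supplies the weight of `H⁻ˢ`; this is the
origin of `N²` in the degenerate equation. -/
theorem toDist_eq_neg_toDist_iff {s : ℝ} (hs : 0 ≤ s) (u : Hs d s) (w : Hs d (-s)) :
    Hs.toDist u = -Hs.toDist w ↔
      weightOp d hs (weightOp d hs (weightedHat d s u)) = -weightedHat d (-s) w := by
  rw [← map_neg,
    (Hs.hasFourierTransform_hat u).eq_iff (Hs.hasFourierTransform_hat (-w)), ← map_neg]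
  have h1 := fn_weightOp_weightedHat hs u
  have h2 := fn_weightOp hs (weightOp d hs (weightedHat d s u))
  have h3 := fn_weightedHat (-w)
  constructor
  · intro h
    refine L2Space.ext ?_
    filter_upwards [h, h1, h2, h3] with ξ t t1 t2 t3
    rw [t2, t1, t3, t]
  · intro h
    filter_upwards [fn_congr h, h1, h2, h3] with ξ t t1 t2 t3
    rw [t2, t1, t3] at t
    exact mul_left_cancel₀ (ofReal_weight_ne_zero (-s) ξ) t

/-- Multiplying by `(1 + |ξ|)^(-α/2)` and splitting it as `(1 + |ξ|)^(-α) (1 + |ξ|)^(α/2)` turns the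
symbol `A` into the bounded one acting on `U`. -/
theorem equation_iff {α : ℝ} {A : Rd d → ℂ} (hA : IsSymbol α A) (w f : Hs d (-(α / 2)))
    (u : Hs d (α / 2)) :
    Hs.toDist w + Hs.toDist (pdo hA (α / 2) u) = Hs.toDist f ↔
      weightedHat d _ w = weightedHat d _ f - mulOp hA.memLp_top (weightedHat d _ u) := by
  rw [((Hs.hasFourierTransform_hat w).add (Hs.hasFourierTransform_hat _)).eq_iff
    (Hs.hasFourierTransform_hat f)]
  have h1 := fn_weightedHat w
  have h2 := fn_weightedHat f
  have h3 := fn_weightedHat u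
  have h4 := fn_mulOp hA.memLp_top (weightedHat d _ u)
  have h5 := fn_sub (weightedHat d _ f) (mulOp hA.memLp_top (weightedHat d _ u))
  have h6 := hat_pdo hA u
  have hw : ∀ ξ : Rd d, (weight (-α) ξ : ℂ) * weight (α / 2) ξ = weight (-(α / 2)) ξ := fun ξ ↦ by
    rw [← Complex.ofReal_mul, weight_mul]
    congr 2
    ring
  constructor
  · intro h
    refine L2Space.ext ?_
    filter_upwards [h, h1, h2, h3, h4, h5, h6] with ξ t t1 t2 t3 t4 t5 t6
    rw [Pi.add_apply, t6] at t
    rw [t5, Pi.sub_apply, t1, t2, t4, t3, ← t, ← hw]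
    ring
  · intro h
    filter_upwards [fn_congr h, h1, h2, h3, h4, h5, h6] with ξ t t1 t2 t3 t4 t5 t6
    rw [t5, Pi.sub_apply, t1, t2, t4, t3] at t
    rw [Pi.add_apply, t6]
    apply mul_left_cancel₀ (ofReal_weight_ne_zero (-(α / 2)) ξ)
    rw [mul_add, t, ← hw]
    ring

/-- The weighted Fourier transform in the space variable on `L²(0, T; Hˢ)`. -/
def timeHat (d : ℕ) (T s : ℝ) : L2Time T (Hs d s) →L[ℂ] L2Time T (L2Space d) :=
  ((weightedHat d s).toContinuousLinearEquiv : Hs d s →L[ℂ] L2Space d).compLpL 2 _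

theorem coeFn_timeHat {T s : ℝ} (u : L2Time T (Hs d s)) :
    ∀ᵐ t ∂(volume : Measure ℝ).restrict (Ioo 0 T),
      timeHat d T s u t = weightedHat d s (u t) :=
  ContinuousLinearMap.coeFn_compLpL _ u

theorem timeHat_bijective (T s : ℝ) : Function.Bijective (timeHat d T s) := by
  constructor
  · intro u v h
    refine Lp.ext ?_
    filter_upwards [coeFn_timeHat u, coeFn_timeHat v] with t h1 h2
    rw [h, h2] at h1
    exact ((weightedHat d s).injective h1).symm
  · intro U
    let J : L2Space d →L[ℂ] Hs d s := (weightedHat d s).symm.toContinuousLinearEquiv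
    refine ⟨J.compLpL 2 _ U, Lp.ext ?_⟩
    filter_upwards [coeFn_timeHat (J.compLpL 2 _ U), J.coeFn_compLpL U] with t h1 h2
    rw [h1, h2]
    exact (weightedHat d s).apply_symm_apply _

theorem weightedHat_integral {T s : ℝ} (φ : ℝ → ℝ) (u : L2Time T (Hs d s)) :
    weightedHat d s (∫ t in Ioo 0 T, φ t • u t) = ∫ t in Ioo 0 T, φ t • timeHat d T s u t := by
  have h := ContinuousLinearEquiv.integral_comp_comm (weightedHat d s).toContinuousLinearEquiv
    (fun t ↦ φ t • u t) (μ := (volume : Measure ℝ).restrict (Ioo 0 T))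
  refine h.symm.trans (integral_congr_ae ?_)
  filter_upwards [coeFn_timeHat u] with t ht
  rw [ht]
  exact ContinuousLinearMap.map_smul_of_tower
    ((weightedHat d s).toContinuousLinearEquiv : Hs d s →L[ℂ] L2Space d) _ _

theorem hasTimeDeriv_iff {T s : ℝ} (hs : 0 ≤ s) (u : L2Time T (Hs d s))
    (w : L2Time T (Hs d (-s))) :
    HasTimeDeriv u w ↔ ∀ η : ℝ → ℝ, ContDiff ℝ ∞ η → HasCompactSupport η →
      tsupport η ⊆ Ioo 0 T →
      weightOp d hs (weightOp d hs (∫ t in Ioo 0 T, deriv η t • timeHat d T s u t)) =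
        -∫ t in Ioo 0 T, η t • timeHat d T (-s) w t := by
  simp only [HasTimeDeriv, toDist_eq_neg_toDist_iff hs, weightedHat_integral]

theorem hasInitialValue_iff {T s : ℝ} (hs : 0 ≤ s) (u : L2Time T (Hs d s))
    (g : Lp ℂ 2 (volume : Measure (Rd d))) :
    HasInitialValue u g ↔ ∃ v : ℝ → L2Space d, ContinuousOn v (Icc 0 T) ∧
      (∀ᵐ t ∂(volume : Measure ℝ).restrict (Ioo 0 T),
        weightOp d hs (timeHat d T s u t) = v t) ∧ v 0 = fourierSpace d g := by
  constructor
  · rintro ⟨v, h1, h2, h3⟩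
    refine ⟨fun t ↦ fourierSpace d (v t), continuous_fourierSpace.comp_continuousOn h1, ?_,
      congrArg (fourierSpace d) h3⟩
    filter_upwards [h2, coeFn_timeHat u] with t t2 t3
    rw [t3, (toDist_eq_toTemperedDistribution_iff hs _ _).1 t2]
  · rintro ⟨v, h1, h2, h3⟩
    refine ⟨fun t ↦ (fourierL2 d).symm (v t),
      (fourierL2 d).symm.continuous.comp_continuousOn h1, ?_, ?_⟩
    · filter_upwards [h2, coeFn_timeHat u] with t t2 t3
      rw [toDist_eq_toTemperedDistribution_iff hs, ← t3, t2]
      exact ((fourierL2 d).apply_symm_apply _).symm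
    · simp only [h3]
      exact (fourierL2 d).symm_apply_apply _

/-- The time derivative is eliminated: the equation determines it as `F - B U`, which is again in
`L²`, so only the identity against test functions remains. -/
theorem isWeakSolution_iff {T α : ℝ} (hs : 0 ≤ α / 2) {A : Rd d → ℂ} (hA : IsSymbol α A)
    (f : L2Time T (Hs d (-(α / 2)))) (g : Lp ℂ 2 (volume : Measure (Rd d)))
    (u : L2Time T (Hs d (α / 2))) :
    IsWeakSolution hA f g u ↔ IsDegenerateSolution (weightOp d hs) (mulOp hA.memLp_top)
      (timeHat d T _ f) (fourierSpace d g) (timeHat d T _ u) := by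
  have hw : ∀ w : L2Time T (Hs d (-(α / 2))),
      (∀ᵐ t ∂(volume : Measure ℝ).restrict (Ioo 0 T),
        Hs.toDist (w t) + Hs.toDist (pdo hA (α / 2) (u t)) = Hs.toDist (f t)) ↔
      ∀ᵐ t ∂(volume : Measure ℝ).restrict (Ioo 0 T), timeHat d T _ w t =
        timeHat d T _ f t - mulOp hA.memLp_top (timeHat d T _ u t) := fun w ↦ by
    refine eventually_congr ?_
    filter_upwards [coeFn_timeHat w, coeFn_timeHat f, coeFn_timeHat u] with t h1 h2 h3
    rw [equation_iff, h1, h2, h3]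
  rw [IsWeakSolution, IsDegenerateSolution, hasInitialValue_iff hs, and_comm]
  refine and_congr_right fun _ ↦ ?_
  simp only [hasTimeDeriv_iff hs, hw]
  constructor
  · rintro ⟨w, h1, h2⟩ η a b c
    rw [h1 η a b c]
    congr 1
    refine integral_congr_ae ?_
    filter_upwards [h2] with t ht
    rw [ht]
  · intro h
    -- The derivative is defined by the equation; surjectivity of `timeHat` brings it back to
    -- `H^(-α/2)`.
    obtain ⟨w, hw'⟩ := (timeHat_bijective (d := d) T (-(α / 2))).2
      (timeHat d T _ f - (mulOp hA.memLp_top).compLpL 2 _ (timeHat d T _ u))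
    have h2 : ∀ᵐ t ∂(volume : Measure ℝ).restrict (Ioo 0 T), timeHat d T _ w t =
        timeHat d T _ f t - mulOp hA.memLp_top (timeHat d T _ u t) := by
      filter_upwards [Lp.coeFn_sub (timeHat d T _ f)
        ((mulOp hA.memLp_top).compLpL 2 _ (timeHat d T _ u)),
        (mulOp hA.memLp_top).coeFn_compLpL (timeHat d T _ u)] with t t1 t2
      rw [hw', t1, Pi.sub_apply, t2]
    refine ⟨w, fun η a b c ↦ ?_, h2⟩
    rw [h η a b c]
    congr 1
    refine integral_congr_ae ?_
    filter_upwards [h2] with t ht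
    rw [ht]

end Translation

end SobolevIndex

end

/-! ### Well-posedness of the parabolic equation -/

theorem mainTheorem1 (d : ℕ) (A : SobolevIndex.Rd d → ℂ) (hA : Measurable A) (α : ℝ)
    (hα : SobolevIndex.HasSobolevIndex A α) (T : ℝ) (hT : 0 < T)
    (f : SobolevIndex.L2Time T (SobolevIndex.Hs d (-(α / 2))))
    (g : MeasureTheory.Lp ℂ 2 (MeasureTheory.volume : MeasureTheory.Measure (SobolevIndex.Rd d))) :
    ∃! u : SobolevIndex.L2Time T (SobolevIndex.Hs d (α / 2)),
      u ∈ SobolevIndex.W1 d T (α / 2) ∧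
        SobolevIndex.IsWeakSolution (hα.isSymbol hA) f g u := by
  have hs : 0 ≤ α / 2 := by linarith [hα.1]
  obtain ⟨c, l, hc, hl, hB⟩ := hα.exists_garding_mulOp hs (hα.isSymbol hA).memLp_top
  have hcut := SobolevIndex.isCutoff hs (hα.isSymbol hA).memLp_top
  obtain ⟨U, hU⟩ := hcut.exists_solution hT (SobolevIndex.inner_weightOp hs) hc hl hB
    (SobolevIndex.fourierSpace d g) (SobolevIndex.timeHat d T _ f)
  obtain ⟨u, rfl⟩ := (SobolevIndex.timeHat_bijective T (α / 2)).2 U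
  rw [← SobolevIndex.isWeakSolution_iff hs (hα.isSymbol hA)] at hU
  refine ⟨u, ⟨?_, hU⟩, fun u' hu' ↦ ?_⟩
  -- Membership in `W1` is already contained in being a weak solution.
  · obtain ⟨⟨w, hw, -⟩, -⟩ := hU
    exact ⟨w, hw⟩
  · exact (SobolevIndex.timeHat_bijective T (α / 2)).1 (hcut.solution_unique hT
      ((SobolevIndex.isWeakSolution_iff hs _ f g u').1 hu'.2)
      ((SobolevIndex.isWeakSolution_iff hs _ f g u).1 hU))
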